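/- Let $D\subseteq\mathbb R^n$ be a domain and let $f_1,\dots,f_m\in C^2(D;\mathbb R^n)$. Consider the time-invariant system $\dot x=\sum_{k=1}^m f_k(x)u_k$, $x\in D$, $u\in\mathbb R^m$. Write $L_gf(x)=\frac{\partial f(x)}{\partial x}g(x)$ and $[f,g]=L_fg-L_gf$. Assume that the system is bracket-generating of degree 2 in $D$: there are $S_1\subseteq\{1,\dots,m\}$, $S_2\subseteq\{1,\dots,m\}^2$ with $|S_1|+|S_2|=n$ such that for all $x\in D$ the vectors $f_i(x)$, $i\in S_1$, and $[f_{j_1},f_{j_2}](x)$, $(j_1,j_2)\in S_2$, span $\mathbb R^n$; and, with $\mathcal F(x)$ the $n\times n$ matrix having these columns, for every family $(K_t)_{t\ge0}$ of compact subsets of $D$ there is $M_F>0$ with $\|\mathcal F^{-1}(x)\|\le M_F$ for all $t\ge0$, $x\in K_t$. Let $x^*:[0,\infty)\to D$ be Lipschitz continuous and let $\delta>0$ be such that $B_\delta(x^*(t))\subset D$ for all $t\ge0$. Assume that for each $r\in(0,\delta)$ there are constants $M_f,L_{fx},L_{2f}>0$, $H_{fx}\ge0$ such that $\|f_k(x)\|\le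 M_f$, $\|f_k(x)-f_k(y)\|\le L_{fx}\|x-y\|$, $\|L_{f_j}f_k(x)\|\le L_{2f}$ and $\|L_{f_l}L_{f_j}f_k(x)\|\le H_{fx}$ for all $t\ge0$, all $x,y$ in the closed ball $\overline{B_r(x^*(t))}$, and all $j,k,l$ (this holds automatically if the curve $x^*$ is bounded). Let $\kappa_{j_1j_2}$, $(j_1,j_2)\in S_2$, be pairwise distinct positive integers. For $\gamma,\varepsilon>0$ put $P(x,t)=\|x-x^*(t)\|^2$ and $a(x,t)=-\gamma\mathcal F^{-1}(x)\nabla_xP(x,t)$, with components $a_i$, $i\in S_1$, and $a_{j_1j_2}$, $(j_1,j_2)\in S_2$, and for $k=1,\dots,m$ let $$u_k^\varepsilon(a,t)=\sum_{i\in S_1}a_i\delta_{ki}+\varepsilon^{-1/2}\sum_{(j_1,j_2)\in S_2}\sqrt{|a_{j_1j_2}|}\;2\sqrt{\pi\kappa_{j_1j_2}}\Big(\delta_{kj_1}\operatorname{sign}(a_{j_1j_2})\cos\tfrac{2\pi\kappa_{j_1j_2}t}{\varepsilon}+\delta_{kj_2}\sin\tfrac{2\pi\kappa_{j_1j_2}t}{\varepsilon}\Big).$$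 A $\pi_\varepsilon$-solution with $x_\pi(t_0)=x^0$ is an absolutely continuous function $x_\pi:[t_0,\infty)\to D$ with $x_\pi(t_0)=x^0$ such that, with $t_j=t_0+\varepsilon j$, for each $j=0,1,2,\dots$ $$\dot x_\pi(t)=\sum_{k=1}^m f_k(x_\pi(t))\,u_k^\varepsilon\big(a(x_\pi(t_j),t_j),t\big),\qquad t\in[t_j,t_{j+1}).$$ Then for every $\rho\in(0,\delta)$ the family of sets $\mathcal L^\rho_t=\{x\in D:\|x-x^*(t)\|\le\rho\}$, $t\ge0$, is exponentially attracting for the closed-loop system in the sense of $\pi_\varepsilon$-solutions: there exist $\Delta>0$, $\bar\gamma>0$ and $\bar\varepsilon:[\bar\gamma,\infty)\to(0,\infty)$ such that for all $t_0\ge0$, $x^0\in B_\Delta(\mathcal L^\rho_{t_0})\cap D$, $\gamma\ge\bar\gamma$ and $\varepsilon\in(0,\bar\varepsilon(\gamma)]$ the $\pi_\varepsilon$-solution $x_\pi$ with $x_\pi(t_0)=x^0$ exists on $[t_0,\infty)$ and is unique, $\operatorname{dist}(x_\pi(t),\mathcal L^\rho_t)\to0$ as $t\to\infty$, and for every $\gamma^*\in[\bar\gamma,\gamma)$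 $$\|x_\pi(t)-x^*(t)\|\le\|x^0-x^*(t_0)\|\,e^{-2\gamma^*(t-t_0-\varepsilon)}+\rho\qquad\text{for all }t\ge t_0.$$ -/

import Mathlib

open Set Filter Topology

noncomputable section

namespace Tracking

/-- `ℝⁿ` with the Euclidean norm. -/
abbrev Vec (n : ℕ) : Type := EuclideanSpace ℝ (Fin n)

/-- The directional derivative `L_g f (x) = (∂f/∂x)(x) g(x)` of a vector field `f` along `g`. -/
def lieDer {n : ℕ} (g f : Vec n → Vec n) (x : Vec n) : Vec n :=
  fderiv ℝ f x (g x)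

/-- The Lie bracket `[f, g] = L_f g - L_g f`. -/
def bracket {n : ℕ} (f g : Vec n → Vec n) (x : Vec n) : Vec n :=
  lieDer f g x - lieDer g f x

/-- The index set of the columns of the matrix `𝓕(x)`: single indices in `S₁`, pairs in `S₂`. -/
abbrev Idx {m : ℕ} (S₁ : Finset (Fin m)) (S₂ : Finset (Fin m × Fin m)) : Type :=
  {i : Fin m // i ∈ S₁} ⊕ {p : Fin m × Fin m // p ∈ S₂}

/-- The columns of `𝓕(x)`: `f_i(x)` for `i ∈ S₁` and `[f_{j₁}, f_{j₂}](x)` for `(j₁, j₂) ∈ S₂`. -/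
def column {n m : ℕ} (f : Fin m → Vec n → Vec n) (S₁ : Finset (Fin m))
    (S₂ : Finset (Fin m × Fin m)) (x : Vec n) : Idx S₁ S₂ → Vec n
  | Sum.inl i => f i.1 x
  | Sum.inr p => bracket (f p.1.1) (f p.1.2) x

/-- The matrix `𝓕(x)`, as the linear map `a ↦ ∑ a_c (column c)`. -/
def frame {n m : ℕ} (f : Fin m → Vec n → Vec n) (S₁ : Finset (Fin m))
    (S₂ : Finset (Fin m × Fin m)) (x : Vec n) : EuclideanSpace ℝ (Idx S₁ S₂) →L[ℝ] Vec n :=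
  ∑ c : Idx S₁ S₂,
    (EuclideanSpace.proj c : EuclideanSpace ℝ (Idx S₁ S₂) →L[ℝ] ℝ).smulRight
      (column f S₁ S₂ x c)

/-- The inverse `𝓕⁻¹(x)`. -/
def frameInv {n m : ℕ} (f : Fin m → Vec n → Vec n) (S₁ : Finset (Fin m))
    (S₂ : Finset (Fin m × Fin m)) (x : Vec n) : Vec n →L[ℝ] EuclideanSpace ℝ (Idx S₁ S₂) :=
  (frame f S₁ S₂ x).inverse

/-- The degree-two bracket-generating assumption on `D`, with index sets `S₁`, `S₂`: the
`|S₁| + |S₂| = n` columns of `𝓕(x)` span `ℝⁿ` at each `x ∈ D`, and `𝓕⁻¹` is uniformly bounded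
along each family `(K t)`, `t ≥ 0`, of compact subsets of `D`. -/
structure BracketGenerating {n m : ℕ} (D : Set (Vec n)) (f : Fin m → Vec n → Vec n)
    (S₁ : Finset (Fin m)) (S₂ : Finset (Fin m × Fin m)) : Prop where
  card_eq : S₁.card + S₂.card = n
  span_eq : ∀ x ∈ D, Submodule.span ℝ (range (column f S₁ S₂ x)) = ⊤
  inv_bound : ∀ K : ℝ → Set (Vec n), (∀ t, 0 ≤ t → IsCompact (K t) ∧ K t ⊆ D) →
    ∃ MF : ℝ, 0 < MF ∧ ∀ t, 0 ≤ t → ∀ x ∈ K t, ‖frameInv f S₁ S₂ x‖ ≤ MF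

/-- Uniform regularity of time-invariant vector fields `f_k` along a family `(K t)`, `t ≥ 0`:
the `f_k` are bounded and Lipschitz on the sets `K t`, and the iterated directional derivatives
`L_{f_j} f_k` and `L_{f_l} L_{f_j} f_k` are bounded there, with constants independent of `t`. -/
def UniformlyRegular {n m : ℕ} (f : Fin m → Vec n → Vec n) (K : ℝ → Set (Vec n)) : Prop :=
  ∃ Mf Lfx L2f Hfx : ℝ, 0 < Mf ∧ 0 < Lfx ∧ 0 < L2f ∧ 0 ≤ Hfx ∧
    ∀ t, 0 ≤ t → ∀ x ∈ K t, ∀ y ∈ K t, ∀ j k l : Fin m,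
      ‖f k x‖ ≤ Mf ∧
      ‖f k x - f k y‖ ≤ Lfx * ‖x - y‖ ∧
      ‖lieDer (f j) (f k) x‖ ≤ L2f ∧
      ‖lieDer (f l) (lieDer (f j) (f k)) x‖ ≤ Hfx

/-- The coefficients `a(x, t) = -γ 𝓕⁻¹(x) ∇ₓP(x, t)`. -/
def coeff {n m : ℕ} (f : Fin m → Vec n → Vec n) (S₁ : Finset (Fin m))
    (S₂ : Finset (Fin m × Fin m)) (P : Vec n → ℝ → ℝ) (γ : ℝ) (x : Vec n) (t : ℝ) :
    EuclideanSpace ℝ (Idx S₁ S₂) :=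
  -(γ • frameInv f S₁ S₂ x (gradient (fun y => P y t) x))

/-- The oscillating component `φ^{(k, ε)}_{j₁ j₂}(t)` with frequency number `κ = κ_{j₁ j₂}`,
for the coefficient value `α = a_{j₁ j₂}`. -/
def dither {m : ℕ} (ε : ℝ) (κ : ℕ) (p : Fin m × Fin m) (α : ℝ) (k : Fin m) (t : ℝ) : ℝ :=
  2 * √(Real.pi * κ) *
    ((if k = p.1 then 1 else 0) * SignType.sign α * Real.cos (2 * Real.pi * κ / ε * t) +
      (if k = p.2 then 1 else 0) * Real.sin (2 * Real.pi * κ / ε * t))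

/-- The control components `u_k = u_k^ε(a, t)`. -/
def control {m : ℕ} (S₁ : Finset (Fin m)) (S₂ : Finset (Fin m × Fin m))
    (κ : Fin m × Fin m → ℕ) (ε : ℝ) (a : EuclideanSpace ℝ (Idx S₁ S₂)) (t : ℝ) (k : Fin m) : ℝ :=
  ∑ i : {i : Fin m // i ∈ S₁}, a (Sum.inl i) * (if k = i.1 then 1 else 0) +
    ε ^ (-(1 / 2) : ℝ) * ∑ p : {p : Fin m × Fin m // p ∈ S₂},
      √|a (Sum.inr p)| * dither ε (κ p.1) p.1 (a (Sum.inr p)) k t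

/-- `x` is a `π_ε`-solution, on `[t₀, ∞)` and with values in `D`, of `ẋ = F(x, u, t)` with the
feedback `u = h(a(x, t), t)`: on each `[t_j, t_{j+1})`, `t_j = t₀ + ε j`, the value of `a` is
frozen at the sampling instant `t_j`. -/
structure IsPiSolution {n : ℕ} {U A : Type*} (D : Set (Vec n)) (F : Vec n → U → ℝ → Vec n)
    (a : Vec n → ℝ → A) (h : A → ℝ → U) (ε t₀ : ℝ) (x₀ : Vec n) (x : ℝ → Vec n) : Prop where
  mem : ∀ t, t₀ ≤ t → x t ∈ D
  absCont : ∀ T, t₀ ≤ T → AbsolutelyContinuousOnInterval x t₀ T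
  init : x t₀ = x₀
  ode : ∀ j : ℕ, ∀ t ∈ Ico (t₀ + ε * j) (t₀ + ε * (j + 1)),
    HasDerivWithinAt x (F (x t) (h (a (x (t₀ + ε * j)) (t₀ + ε * j)) t) t)
      (Ico (t₀ + ε * j) (t₀ + ε * (j + 1))) t

/-- The quadratic potential `P(x, t) = ‖x - x*(t)‖²`. -/
def potential {n : ℕ} (xs : ℝ → Vec n) (x : Vec n) (t : ℝ) : ℝ := ‖x - xs t‖ ^ 2

/-- `π_ε`-solutions of `ẋ = ∑ f_k(x) u_k` with the oscillating controls generated by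
`P(x, t) = ‖x - x*(t)‖²`. -/
def IsClosedLoopSolution {n m : ℕ} (D : Set (Vec n)) (f : Fin m → Vec n → Vec n)
    (S₁ : Finset (Fin m)) (S₂ : Finset (Fin m × Fin m)) (κ : Fin m × Fin m → ℕ)
    (xs : ℝ → Vec n) (γ ε t₀ : ℝ) (x₀ : Vec n) (x : ℝ → Vec n) : Prop :=
  IsPiSolution D (fun y (u : Fin m → ℝ) _ => ∑ k, u k • f k y)
    (coeff f S₁ S₂ (potential xs) γ) (control S₁ S₂ κ ε) ε t₀ x₀ x

/-- The set `𝓛^ρ_t = {x ∈ D : ‖x - x*(t)‖ ≤ ρ}`. -/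
def tube {n : ℕ} (D : Set (Vec n)) (xs : ℝ → Vec n) (ρ t : ℝ) : Set (Vec n) :=
  {x | x ∈ D ∧ ‖x - xs t‖ ≤ ρ}

/-- The family `(𝓛^ρ_t)`, `t ≥ 0`, is exponentially attracting for the closed loop, in the sense
of `π_ε`-solutions: there are `Δ > 0`, `γ̄ > 0` and `ε̄ : [γ̄, ∞) → (0, ∞)` such that for all
`t₀ ≥ 0`, `x⁰ ∈ B_Δ(𝓛^ρ_{t₀}) ∩ D`, `γ ≥ γ̄` and `ε ∈ (0, ε̄(γ)]` the `π_ε`-solution starting at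
`x⁰` is well defined (it exists on `[t₀, ∞)` and is unique), its distance to `𝓛^ρ_t` tends to `0`,
and it satisfies the exponential estimate with each `γ* ∈ [γ̄, γ)`. -/
def ExponentiallyAttracting {n m : ℕ} (D : Set (Vec n)) (f : Fin m → Vec n → Vec n)
    (S₁ : Finset (Fin m)) (S₂ : Finset (Fin m × Fin m)) (κ : Fin m × Fin m → ℕ)
    (xs : ℝ → Vec n) (ρ : ℝ) : Prop :=
  ∃ Δ : ℝ, 0 < Δ ∧ ∃ γbar : ℝ, 0 < γbar ∧ ∃ εbar : ℝ → ℝ, (∀ γ, γbar ≤ γ → 0 < εbar γ) ∧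
    ∀ t₀, 0 ≤ t₀ → ∀ x₀ ∈ Metric.thickening Δ (tube D xs ρ t₀) ∩ D,
      ∀ γ, γbar ≤ γ → ∀ ε ∈ Ioc 0 (εbar γ),
        ∃ x : ℝ → Vec n,
          IsClosedLoopSolution D f S₁ S₂ κ xs γ ε t₀ x₀ x ∧
          (∀ y, IsClosedLoopSolution D f S₁ S₂ κ xs γ ε t₀ x₀ y → EqOn y x (Ici t₀)) ∧
          Tendsto (fun t => Metric.infDist (x t) (tube D xs ρ t)) atTop (𝓝 0) ∧
          ∀ γs, γbar ≤ γs → γs < γ → ∀ t, t₀ ≤ t →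
            ‖x t - xs t‖ ≤ ‖x₀ - xs t₀‖ * Real.exp (-2 * γs * (t - t₀ - ε)) + ρ

end Tracking

end

noncomputable section

namespace Tracking

/-! Over one sampling period the controls are a constant plus `ε^{-1/2}` times a trigonometric
polynomial. In the second-order expansion of the solution, the first-order terms keep only the
constant parts. Among the iterated integrals of two controls, only a sine and a cosine of the same
frequency contribute at order `ε`. As the frequencies are distinct, the surviving coefficients are
antisymmetric in the two controls, so the derivatives `L_{f_l} f_k` combine into exactly the
brackets `[f_{j₁}, f_{j₂}]`. The amplitudes are normalised so that the displacement is `ε 𝓕(z) a +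
O(ε^{3/2})` (`abs_iterated_integral_sub_le`, `second_order_expansion`, `norm_step_sub_le`).

Since `a = -γ 𝓕⁻¹(z) ∇P`, this displacement is an Euler step of `ẋ = -2γ (x - x*)`, with an error
constant uniform in the time and in the state near the curve (`exists_step`). The tracking error
`e_j` at the sampling instants then satisfies `e_{j+1} ≤ (1 - q) e_j + L ε + C ε^{3/2}` with `q =
2γε`, where `L ε` accounts for the motion of the reference. If `γ ρ ≥ L + 1` and `ε` is small
depending on `γ`, the last two terms are at most `q ρ / 2`. Hence the error never leaves the region
where the estimates hold and decays geometrically to the level `ρ / 2`. The motion between samples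
adds at most `ρ / 4`; the remaining `ρ / 4` of slack makes the solution enter the tube in finite
time. -/

/-- The trigonometric polynomial `∑ (A_p cos (2π N_p t / ε) + B_p sin (2π N_p t / ε))`. -/
def osc {ι : Type*} [Fintype ι] (ε : ℝ) (N : ι → ℕ) (A B : ι → ℝ) (t : ℝ) : ℝ :=
  ∑ p, (A p * Real.cos (2 * Real.pi * N p / ε * t) + B p * Real.sin (2 * Real.pi * N p / ε * t))

/-! ### Integrals of oscillating signals over one period. -/

lemma integral_cos_period {ε : ℝ} (hε : 0 < ε) {j : ℤ} (hj : j ≠ 0) (s : ℝ) :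
    ∫ t in s..s + ε, Real.cos (2 * Real.pi * j / ε * t) = 0 := by
  have hc : 2 * Real.pi * j / ε ≠ 0 := by
    have : (j : ℝ) ≠ 0 := by exact_mod_cast hj
    positivity
  rw [intervalIntegral.integral_comp_mul_left _ hc, integral_cos]
  have : 2 * Real.pi * j / ε * (s + ε) = 2 * Real.pi * j / ε * s + j * (2 * Real.pi) := by
    field_simp
  rw [this, Real.sin_add_int_mul_two_pi]
  simp

lemma integral_sin_period {ε : ℝ} (hε : 0 < ε) (j : ℤ) (s : ℝ) :
    ∫ t in s..s + ε, Real.sin (2 * Real.pi * j / ε * t) = 0 := by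
  rcases eq_or_ne j 0 with rfl | hj
  · simp
  have hc : 2 * Real.pi * j / ε ≠ 0 := by
    have : (j : ℝ) ≠ 0 := by exact_mod_cast hj
    positivity
  rw [intervalIntegral.integral_comp_mul_left _ hc, integral_sin]
  have : 2 * Real.pi * j / ε * (s + ε) = 2 * Real.pi * j / ε * s + j * (2 * Real.pi) := by
    field_simp
  rw [this, Real.cos_add_int_mul_two_pi]
  simp

lemma integral_cos_mul_cos_period {ε : ℝ} (hε : 0 < ε) {p q : ℕ} (hp : 0 < p) (s : ℝ) :
    ∫ t in s..s + ε, Real.cos (2 * Real.pi * p / ε * t) * Real.cos (2 * Real.pi * q / ε * t) =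
      if p = q then ε / 2 else 0 := by
  have e : ∀ t, Real.cos (2 * Real.pi * p / ε * t) * Real.cos (2 * Real.pi * q / ε * t) =
      (1 / 2) * Real.cos (2 * Real.pi * ((p - q : ℤ) : ℝ) / ε * t) +
      (1 / 2) * Real.cos (2 * Real.pi * ((p + q : ℤ) : ℝ) / ε * t) := by
    intro t
    have h1 : 2 * Real.pi * ((p - q : ℤ) : ℝ) / ε * t =
      2 * Real.pi * p / ε * t - 2 * Real.pi * q / ε * t := by push_cast; ring
    have h2 : 2 * Real.pi * ((p + q : ℤ) : ℝ) / ε * t =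
      2 * Real.pi * p / ε * t + 2 * Real.pi * q / ε * t := by push_cast; ring
    rw [h1, h2, Real.cos_add, Real.cos_sub]; ring
  simp_rw [e]
  rw [intervalIntegral.integral_add (by apply Continuous.intervalIntegrable; fun_prop)
    (by apply Continuous.intervalIntegrable; fun_prop), intervalIntegral.integral_const_mul,
    intervalIntegral.integral_const_mul, integral_cos_period (j := p + q) hε (by omega)]
  split_ifs with h
  · subst h; simp; ring
  · rw [integral_cos_period (j := p - q) hε (by omega)]; simp

lemma integral_sin_mul_sin_period {ε : ℝ} (hε : 0 < ε) {p q : ℕ} (hp : 0 < p) (s : ℝ) :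
    ∫ t in s..s + ε, Real.sin (2 * Real.pi * p / ε * t) * Real.sin (2 * Real.pi * q / ε * t) =
      if p = q then ε / 2 else 0 := by
  have e : ∀ t, Real.sin (2 * Real.pi * p / ε * t) * Real.sin (2 * Real.pi * q / ε * t) =
      (1 / 2) * Real.cos (2 * Real.pi * ((p - q : ℤ) : ℝ) / ε * t) -
      (1 / 2) * Real.cos (2 * Real.pi * ((p + q : ℤ) : ℝ) / ε * t) := by
    intro t
    have h1 : 2 * Real.pi * ((p - q : ℤ) : ℝ) / ε * t =
      2 * Real.pi * p / ε * t - 2 * Real.pi * q / ε * t := by push_cast; ring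
    have h2 : 2 * Real.pi * ((p + q : ℤ) : ℝ) / ε * t =
      2 * Real.pi * p / ε * t + 2 * Real.pi * q / ε * t := by push_cast; ring
    rw [h1, h2, Real.cos_add, Real.cos_sub]; ring
  simp_rw [e]
  rw [intervalIntegral.integral_sub (by apply Continuous.intervalIntegrable; fun_prop)
    (by apply Continuous.intervalIntegrable; fun_prop), intervalIntegral.integral_const_mul,
    intervalIntegral.integral_const_mul, integral_cos_period (j := p + q) hε (by omega)]
  split_ifs with h
  · subst h; simp; ring
  · rw [integral_cos_period (j := p - q) hε (by omega)]; simp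

lemma integral_cos_mul_sin_period {ε : ℝ} (hε : 0 < ε) (p q : ℕ) (s : ℝ) :
    ∫ t in s..s + ε, Real.cos (2 * Real.pi * p / ε * t) * Real.sin (2 * Real.pi * q / ε * t) =
      0 := by
  have e : ∀ t, Real.cos (2 * Real.pi * p / ε * t) * Real.sin (2 * Real.pi * q / ε * t) =
      (1 / 2) * Real.sin (2 * Real.pi * ((p + q : ℤ) : ℝ) / ε * t) -
      (1 / 2) * Real.sin (2 * Real.pi * ((p - q : ℤ) : ℝ) / ε * t) := by
    intro t
    have h1 : 2 * Real.pi * ((p - q : ℤ) : ℝ) / ε * t =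
      2 * Real.pi * p / ε * t - 2 * Real.pi * q / ε * t := by push_cast; ring
    have h2 : 2 * Real.pi * ((p + q : ℤ) : ℝ) / ε * t =
      2 * Real.pi * p / ε * t + 2 * Real.pi * q / ε * t := by push_cast; ring
    rw [h1, h2, Real.sin_add, Real.sin_sub]; ring
  simp_rw [e]
  rw [intervalIntegral.integral_sub (by apply Continuous.intervalIntegrable; fun_prop)
    (by apply Continuous.intervalIntegrable; fun_prop), intervalIntegral.integral_const_mul,
    intervalIntegral.integral_const_mul, integral_sin_period hε, integral_sin_period hε]
  simp

section osc

variable {ι : Type*} [Fintype ι] {ε : ℝ} {N : ι → ℕ}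

@[fun_prop]
lemma continuous_osc (ε : ℝ) (N : ι → ℕ) (A B : ι → ℝ) : Continuous (osc ε N A B) := by
  unfold osc; fun_prop

lemma abs_osc_le (ε : ℝ) (N : ι → ℕ) (A B : ι → ℝ) (t : ℝ) :
    |osc ε N A B t| ≤ ∑ p, (|A p| + |B p|) := by
  refine (Finset.abs_sum_le_sum_abs _ _).trans (Finset.sum_le_sum fun p _ => ?_)
  refine (abs_add_le _ _).trans (add_le_add ?_ ?_)
  · rw [abs_mul]
    exact mul_le_of_le_one_right (abs_nonneg _) (Real.abs_cos_le_one _)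
  · rw [abs_mul]
    exact mul_le_of_le_one_right (abs_nonneg _) (Real.abs_sin_le_one _)

lemma integral_osc (hε : 0 < ε) (hN : ∀ p, 0 < N p) (A B : ι → ℝ) (s : ℝ) :
    ∫ t in s..s + ε, osc ε N A B t = 0 := by
  unfold osc
  rw [intervalIntegral.integral_finsetSum
    (fun p _ => by apply Continuous.intervalIntegrable; fun_prop)]
  refine Finset.sum_eq_zero fun p _ => ?_
  have h1 := integral_cos_period hε (j := N p) (by exact_mod_cast (hN p).ne') s
  have h2 := integral_sin_period hε (N p) s
  push_cast at h1 h2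
  rw [intervalIntegral.integral_add (by apply Continuous.intervalIntegrable; fun_prop)
    (by apply Continuous.intervalIntegrable; fun_prop), intervalIntegral.integral_const_mul,
    intervalIntegral.integral_const_mul, h1, h2]
  simp

/-- Orthogonality of the trigonometric system. Injectivity of `N` is what excludes cross terms
between different indices, and so between different brackets. -/
lemma integral_osc_mul_osc (hε : 0 < ε) (hN : ∀ p, 0 < N p) (hinj : Function.Injective N)
    (A B A' B' : ι → ℝ) (s : ℝ) :
    ∫ t in s..s + ε, osc ε N A B t * osc ε N A' B' t =
      ε / 2 * ∑ p, (A p * A' p + B p * B' p) := by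
  classical
  have e : ∀ t, osc ε N A B t * osc ε N A' B' t = ∑ p, ∑ q,
      (A p * A' q * (Real.cos (2 * Real.pi * N p / ε * t) * Real.cos (2 * Real.pi * N q / ε * t)) +
      A p * B' q * (Real.cos (2 * Real.pi * N p / ε * t) * Real.sin (2 * Real.pi * N q / ε * t)) +
      B p * A' q * (Real.cos (2 * Real.pi * N q / ε * t) * Real.sin (2 * Real.pi * N p / ε * t)) +
      B p * B' q * (Real.sin (2 * Real.pi * N p / ε * t) *
        Real.sin (2 * Real.pi * N q / ε * t))) := by
    intro t
    unfold osc
    rw [Finset.sum_mul_sum]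
    refine Finset.sum_congr rfl fun p _ => Finset.sum_congr rfl fun q _ => ?_
    ring
  simp_rw [e]
  rw [intervalIntegral.integral_finsetSum
    (fun p _ => by apply Continuous.intervalIntegrable; fun_prop), Finset.mul_sum]
  refine Finset.sum_congr rfl fun p _ => ?_
  rw [intervalIntegral.integral_finsetSum
    (fun p _ => by apply Continuous.intervalIntegrable; fun_prop)]
  have : ∀ q, ∫ t in s..s + ε,
      (A p * A' q * (Real.cos (2 * Real.pi * N p / ε * t) * Real.cos (2 * Real.pi * N q / ε * t)) +
      A p * B' q * (Real.cos (2 * Real.pi * N p / ε * t) * Real.sin (2 * Real.pi * N q / ε * t)) +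
      B p * A' q * (Real.cos (2 * Real.pi * N q / ε * t) * Real.sin (2 * Real.pi * N p / ε * t)) +
      B p * B' q * (Real.sin (2 * Real.pi * N p / ε * t) *
        Real.sin (2 * Real.pi * N q / ε * t))) =
      if p = q then ε / 2 * (A p * A' p + B p * B' p) else 0 := by
    intro q
    iterate 3 rw [intervalIntegral.integral_add (by apply Continuous.intervalIntegrable; fun_prop)
      (by apply Continuous.intervalIntegrable; fun_prop)]
    simp only [intervalIntegral.integral_const_mul]
    rw [integral_cos_mul_cos_period hε (hN p), integral_sin_mul_sin_period hε (hN p),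
      integral_cos_mul_sin_period hε, integral_cos_mul_sin_period hε]
    simp only [hinj.eq_iff]
    split_ifs with h
    · subst h; ring
    · simp
  simp [this]

/-- The primitive is again an `osc` with the same frequencies, so orthogonality applies to a signal
times the primitive of another. Its amplitudes carry a factor `ε`, which offsets the product of two
factors `ε^{-1/2}`. -/
lemma hasDerivAt_osc_primitive (hε : 0 < ε) (hN : ∀ p, 0 < N p) (A B : ι → ℝ) (t : ℝ) :
    HasDerivAt (osc ε N (fun p => -(B p * (ε / (2 * Real.pi * N p))))
      (fun p => A p * (ε / (2 * Real.pi * N p)))) (osc ε N A B t) t := by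
  unfold osc
  refine HasDerivAt.fun_sum fun p _ => ?_
  have hn : (0 : ℝ) < N p := by exact_mod_cast hN p
  have h0 : HasDerivAt (fun t => 2 * Real.pi * N p / ε * t) (2 * Real.pi * N p / ε) t := by
    simpa using (hasDerivAt_id t).const_mul (2 * Real.pi * N p / ε)
  refine ((h0.cos.const_mul (-(B p * (ε / (2 * Real.pi * N p))))).fun_add
    (h0.sin.const_mul (A p * (ε / (2 * Real.pi * N p))))).congr_deriv ?_
  have := Real.pi_pos
  field_simp
  ring

lemma integral_osc_eq_sub (hε : 0 < ε) (hN : ∀ p, 0 < N p) (A B : ι → ℝ) (s t : ℝ) :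
    ∫ τ in s..t, osc ε N A B τ =
      osc ε N (fun p => -(B p * (ε / (2 * Real.pi * N p))))
        (fun p => A p * (ε / (2 * Real.pi * N p))) t -
      osc ε N (fun p => -(B p * (ε / (2 * Real.pi * N p))))
        (fun p => A p * (ε / (2 * Real.pi * N p))) s :=
  intervalIntegral.integral_eq_sub_of_hasDerivAt
    (fun τ _ => hasDerivAt_osc_primitive hε hN A B τ)
    ((continuous_osc ε N A B).intervalIntegrable _ _)

lemma integral_const_add_osc (hε : 0 < ε) (hN : ∀ p, 0 < N p) (α c : ℝ) (A B : ι → ℝ) (s : ℝ) :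
    ∫ t in s..s + ε, (α + c * osc ε N A B t) = ε * α := by
  rw [intervalIntegral.integral_add (by simp)
    (by apply Continuous.intervalIntegrable; fun_prop), intervalIntegral.integral_const_mul,
    integral_osc hε hN]
  simp

/-- The iterated integral over one period of two signals, each of them a constant plus
`ε^{-1/2}` times an oscillation: to leading order only resonant products contribute. -/
lemma abs_iterated_integral_sub_le (hε : 0 < ε) (hε1 : ε ≤ 1) (hN : ∀ p, 0 < N p)
    (hinj : Function.Injective N) {α α' Q : ℝ} {A B A' B' : ι → ℝ} (hα : |α| ≤ Q) (hα' : |α'| ≤ Q)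
    (hv : ∀ t, |osc ε N A B t| ≤ Q) (hv' : ∀ t, |osc ε N A' B' t| ≤ Q) (s : ℝ) :
    |(∫ t in s..s + ε, (α + (√ε)⁻¹ * osc ε N A B t) *
        ∫ τ in s..t, (α' + (√ε)⁻¹ * osc ε N A' B' τ)) -
      ε * ∑ p, (B p * A' p - A p * B' p) / (4 * Real.pi * N p)| ≤ 3 * Q ^ 2 * (ε * √ε) := by
  have hs : 0 < √ε := Real.sqrt_pos.2 hε
  have hss : √ε * √ε = ε := Real.mul_self_sqrt hε.le
  have hs1 : √ε ≤ 1 := Real.sqrt_le_one.2 hε1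
  have hQ : 0 ≤ Q := (abs_nonneg _).trans hα
  set c := (√ε)⁻¹ with hc
  have hc1 : 1 ≤ c := (one_le_inv₀ hs).2 hs1
  have hcc : c * c * ε = 1 := by rw [← hss, hc]; field_simp
  have hce : c * ε = √ε := by
    have : c * (√ε * √ε) = √ε := by rw [hc]; field_simp
    rwa [hss] at this
  set v := osc ε N A B with hv_def
  set v' := osc ε N A' B' with hv'_def
  set W := osc ε N (fun p => -(B' p * (ε / (2 * Real.pi * N p))))
        (fun p => A' p * (ε / (2 * Real.pi * N p))) with hW_def
  have hvc : Continuous v := continuous_osc _ _ _ _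
  have hvc' : Continuous v' := continuous_osc _ _ _ _
  have hWc : Continuous W := continuous_osc _ _ _ _
  have hU : ∀ t, ∫ τ in s..t, (α' + c * v' τ) = α' * (t - s) + c * (W t - W s) := by
    intro t
    rw [intervalIntegral.integral_add (by simp)
      (by apply Continuous.intervalIntegrable; fun_prop), intervalIntegral.integral_const_mul,
      integral_osc_eq_sub hε hN]
    rw [intervalIntegral.integral_const, smul_eq_mul, mul_comm (t - s)]
  have hUb : ∀ t ∈ Icc s (s + ε), |∫ τ in s..t, (α' + c * v' τ)| ≤ (2 * Q * c) * ε := by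
    intro t ht
    have h1 := intervalIntegral.norm_integral_le_of_norm_le_const (a := s) (b := t)
      (f := fun τ => α' + c * v' τ) (C := 2 * Q * c) (by
        intro τ _
        rw [Real.norm_eq_abs]
        refine (abs_add_le _ _).trans ?_
        rw [abs_mul, abs_of_pos (by linarith : 0 < c)]
        nlinarith [hv' τ])
    rw [Real.norm_eq_abs] at h1
    refine h1.trans ?_
    gcongr
    rw [abs_of_nonneg (by linarith [ht.1])]
    linarith [ht.2]
  have hUc : Continuous fun t => ∫ τ in s..t, (α' + c * v' τ) := by
    simp_rw [hU]; fun_prop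
  -- Only `c * c * (v * W)` is resonant. The term with the constant `W s` integrates to zero over
  -- the period, and the first bracket is pointwise at most `3 * Q ^ 2 * (c * ε)`, where `c * ε =
  -- √ε`.
  have hsplit : ∀ t, (α + c * v t) * ∫ τ in s..t, (α' + c * v' τ) =
      (α * (∫ τ in s..t, (α' + c * v' τ)) + c * α' * (v t * (t - s))) +
        (c * c * (v t * W t) - c * c * W s * v t) := by
    intro t; rw [hU]; ring
  have hres : ∫ t in s..s + ε, v t * W t =
      ε * ε * ∑ p, (B p * A' p - A p * B' p) / (4 * Real.pi * N p) := by
    rw [integral_osc_mul_osc hε hN hinj, Finset.mul_sum, Finset.mul_sum]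
    refine Finset.sum_congr rfl fun p _ => ?_
    have hn : (0 : ℝ) < N p := by exact_mod_cast hN p
    have := Real.pi_pos
    field_simp
    ring
  simp_rw [hsplit]
  rw [intervalIntegral.integral_add (by apply Continuous.intervalIntegrable; fun_prop)
      (by apply Continuous.intervalIntegrable; fun_prop),
    intervalIntegral.integral_sub (by apply Continuous.intervalIntegrable; fun_prop)
      (by apply Continuous.intervalIntegrable; fun_prop),
    intervalIntegral.integral_const_mul, intervalIntegral.integral_const_mul,
    integral_osc hε hN, hres]
  have : c * c * (ε * ε * ∑ p, (B p * A' p - A p * B' p) / (4 * Real.pi * N p)) =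
      ε * ∑ p, (B p * A' p - A p * B' p) / (4 * Real.pi * N p) := by
    linear_combination (ε * ∑ p, (B p * A' p - A p * B' p) / (4 * Real.pi * N p)) * hcc
  rw [this, mul_zero, sub_zero, add_sub_cancel_right, ← Real.norm_eq_abs]
  have h2 := intervalIntegral.norm_integral_le_of_norm_le_const (a := s) (b := s + ε)
    (f := fun t => α * (∫ τ in s..t, (α' + c * v' τ)) + c * α' * (v t * (t - s)))
    (C := 3 * Q ^ 2 * (c * ε)) (by
      intro t ht
      rw [uIoc_of_le (by linarith)] at ht
      have htI : t ∈ Icc s (s + ε) := Ioc_subset_Icc_self ht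
      refine (norm_add_le _ _).trans ?_
      simp only [Real.norm_eq_abs, abs_mul]
      rw [abs_of_pos (by linarith : 0 < c), abs_of_nonneg (by linarith [htI.1] : 0 ≤ t - s)]
      have h3 : |α| * |∫ τ in s..t, (α' + c * v' τ)| ≤ Q * ((2 * Q * c) * ε) := by
        gcongr; exact hUb t htI
      have h4 : c * |α'| * (|v t| * (t - s)) ≤ c * Q * (Q * ε) := by
        have h5 : t - s ≤ ε := by linarith [htI.2]
        have h6 : 0 ≤ t - s := by linarith [htI.1]
        have h7 := hv t
        gcongr
      linarith [h3, h4])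
  refine h2.trans (le_of_eq ?_)
  rw [add_sub_cancel_left, abs_of_pos hε, hce]
  ring

end osc

/-! ### Second-order expansion along solutions. -/

section expansion

variable {n m : ℕ} {D : Set (Vec n)} {f : Fin m → Vec n → Vec n}

lemma differentiableAt_lieDer (hDo : IsOpen D) {f g : Vec n → Vec n} (hf : ContDiffOn ℝ 2 f D)
    (hg : ContDiffOn ℝ 2 g D) {x : Vec n} (hx : x ∈ D) : DifferentiableAt ℝ (lieDer g f) x := by
  have hD : D ∈ 𝓝 x := hDo.mem_nhds hx
  have h1 : DifferentiableAt ℝ (fderiv ℝ f) x :=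
    ((hf.contDiffAt hD).fderiv_right (m := 1) (by norm_num)).differentiableAt (by norm_num)
  have h2 : DifferentiableAt ℝ g x := (hg.contDiffAt hD).differentiableAt (by norm_num)
  exact h1.clm_apply h2

lemma hasDerivWithinAt_comp_solution {x : ℝ → Vec n} {s : Set ℝ} {t : ℝ} {c : Fin m → ℝ}
    (hx : HasDerivWithinAt x (∑ k, c k • f k (x t)) s t) {φ : Vec n → Vec n}
    (hφ : DifferentiableAt ℝ φ (x t)) :
    HasDerivWithinAt (fun τ => φ (x τ)) (∑ k, c k • lieDer (f k) φ (x t)) s t := by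
  refine (hφ.hasFDerivAt.comp_hasDerivWithinAt t hx).congr_deriv ?_
  simp [lieDer, map_sum, map_smul]

lemma norm_sum_smul_le {E : Type*} [NormedAddCommGroup E] [NormedSpace ℝ E] {c : Fin m → ℝ}
    {v : Fin m → E} {U C : ℝ} (hc : ∀ k, |c k| ≤ U) (hv : ∀ k, ‖v k‖ ≤ C) :
    ‖∑ k, c k • v k‖ ≤ m * U * C := by
  refine (norm_sum_le _ _).trans ((Finset.sum_le_card_nsmul _ _ (U * C) fun k _ => ?_).trans ?_)
  · rw [norm_smul, Real.norm_eq_abs]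
    exact mul_le_mul (hc k) (hv k) (norm_nonneg _) ((abs_nonneg _).trans (hc k))
  · simp [mul_assoc]

/-- The mean value inequality is applied three times: to `L_{f_l} f_k`, to `f_k` and to the curve
itself, each time after subtracting the expansion already known. Every application costs a factor `m
* U * (b - a)`. For controls of size `ε^{-1/2}` on an interval of length `ε`, the remainder is
`O(ε^{3/2})`. -/
lemma second_order_expansion (hDo : IsOpen D) (hf : ∀ k, ContDiffOn ℝ 2 (f k) D)
    {x : ℝ → Vec n} {u : Fin m → ℝ → ℝ} (hu : ∀ k, Continuous (u k)) {a b : ℝ} (hab : a ≤ b)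
    (hx : ∀ t ∈ Icc a b, HasDerivWithinAt x (∑ k, u k t • f k (x t)) (Icc a b) t)
    (hxD : ∀ t ∈ Icc a b, x t ∈ D) {U H : ℝ} (hU0 : 0 ≤ U) (hH0 : 0 ≤ H)
    (hU : ∀ k t, |u k t| ≤ U)
    (hH : ∀ t ∈ Icc a b, ∀ j k l, ‖lieDer (f l) (lieDer (f j) (f k)) (x t)‖ ≤ H) :
    ‖x b - x a - ∑ k, (∫ s in a..b, u k s) • f k (x a) -
      ∑ k, ∑ l, (∫ s in a..b, u k s * ∫ τ in a..s, u l τ) • lieDer (f l) (f k) (x a)‖ ≤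
      (m * U * (b - a)) ^ 3 * H := by
  have hdf : ∀ k, ∀ t ∈ Icc a b, DifferentiableAt ℝ (f k) (x t) := fun k t ht =>
    ((hf k).contDiffAt (hDo.mem_nhds (hxD t ht))).differentiableAt (by norm_num)
  have hba : 0 ≤ b - a := sub_nonneg.2 hab
  have hprim : ∀ {g : ℝ → ℝ}, Continuous g → ∀ t, HasDerivWithinAt (fun t => ∫ s in a..t, g s)
      (g t) (Icc a b) t := fun hg t => (hg.integral_hasStrictDerivAt a t).hasDerivAt.hasDerivWithinAt
  have hUc : ∀ l, Continuous fun t => ∫ τ in a..t, u l τ := fun l =>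
    continuous_iff_continuousAt.2 fun t =>
      ((hu l).integral_hasStrictDerivAt a t).hasDerivAt.continuousAt
  -- variation of the iterated directional derivatives along the solution
  have h1 : ∀ l k, ∀ t ∈ Icc a b,
      ‖lieDer (f l) (f k) (x t) - lieDer (f l) (f k) (x a)‖ ≤ m * U * H * (b - a) := by
    intro l k t ht
    refine (norm_image_sub_le_of_norm_deriv_le_segment' (C := m * U * H)
      (f := fun t => lieDer (f l) (f k) (x t))
      (fun s hs => hasDerivWithinAt_comp_solution (hx s hs)
        (differentiableAt_lieDer hDo (hf k) (hf l) (hxD s hs)))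
      (fun s hs => norm_sum_smul_le (fun j => hU j s)
        (fun j => hH s (Ico_subset_Icc_self hs) l k j)) t ht).trans ?_
    have : t - a ≤ b - a := by linarith [ht.2]
    gcongr
  have h2 : ∀ k, ∀ t ∈ Icc a b,
      ‖f k (x t) - f k (x a) - ∑ l, (∫ τ in a..t, u l τ) • lieDer (f l) (f k) (x a)‖ ≤
        m * U * (m * U * H * (b - a)) * (b - a) := by
    intro k t ht
    have := norm_image_sub_le_of_norm_deriv_le_segment' (a := a) (b := b)
      (C := m * U * (m * U * H * (b - a)))
      (f := fun t => f k (x t) - ∑ l, (∫ τ in a..t, u l τ) • lieDer (f l) (f k) (x a))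
      (f' := fun t => ∑ l, u l t • (lieDer (f l) (f k) (x t) - lieDer (f l) (f k) (x a)))
      (fun s hs => by
        refine ((hasDerivWithinAt_comp_solution (hx s hs) (hdf k s hs)).sub
          (HasDerivWithinAt.fun_sum fun l _ =>
            (hprim (hu l) s).smul_const (lieDer (f l) (f k) (x a)))).congr_deriv ?_
        simp [smul_sub, Finset.sum_sub_distrib])
      (fun s hs => norm_sum_smul_le (fun j => hU j s)
        (fun j => h1 j k s (Ico_subset_Icc_self hs))) t ht
    simp only [intervalIntegral.integral_same, zero_smul, Finset.sum_const_zero, sub_zero] at this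
    rw [sub_right_comm]
    refine this.trans ?_
    have : t - a ≤ b - a := by linarith [ht.2]
    gcongr
  have := norm_image_sub_le_of_norm_deriv_le_segment' (a := a) (b := b)
      (C := m * U * (m * U * (m * U * H * (b - a)) * (b - a)))
      (f := fun t => x t - ∑ k, (∫ s in a..t, u k s) • f k (x a) -
        ∑ k, ∑ l, (∫ s in a..t, u k s * ∫ τ in a..s, u l τ) • lieDer (f l) (f k) (x a))
      (f' := fun t => ∑ k, u k t • (f k (x t) - f k (x a) -
        ∑ l, (∫ τ in a..t, u l τ) • lieDer (f l) (f k) (x a)))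
      (fun s hs => by
        refine (((hx s hs).sub (HasDerivWithinAt.fun_sum fun k _ =>
          (hprim (hu k) s).smul_const (f k (x a)))).sub
          (HasDerivWithinAt.fun_sum fun k _ => HasDerivWithinAt.fun_sum fun l _ =>
            (hprim ((hu k).mul (hUc l)) s).smul_const (lieDer (f l) (f k) (x a)))).congr_deriv ?_
        simp [smul_sub, Finset.sum_sub_distrib, Finset.smul_sum, mul_smul])
      (fun s hs => norm_sum_smul_le (fun j => hU j s)
        (fun j => h2 j s (Ico_subset_Icc_self hs))) b (right_mem_Icc.2 hab)
  simp only [intervalIntegral.integral_same, zero_smul, Finset.sum_const_zero, sub_zero] at this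
  rw [sub_right_comm (x b), sub_right_comm _ (x a)]
  refine this.trans (le_of_eq ?_)
  ring

end expansion

/-! ### The matrix `𝓕(x)` and the feedback coefficients. -/

section frame

variable {n m : ℕ} {D : Set (Vec n)} {f : Fin m → Vec n → Vec n}
  {S₁ : Finset (Fin m)} {S₂ : Finset (Fin m × Fin m)}

lemma frame_apply (x : Vec n) (a : EuclideanSpace ℝ (Idx S₁ S₂)) :
    frame f S₁ S₂ x a = ∑ c, a c • column f S₁ S₂ x c := by
  simp [frame]

/-- `ContinuousLinearMap.inverse` is zero on non-invertible maps, so invertibility must be shown: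
spanning columns give surjectivity, and `|S₁| + |S₂| = n` turns this into bijectivity. -/
lemma frame_frameInv (h : BracketGenerating D f S₁ S₂) {x : Vec n} (hx : x ∈ D) (v : Vec n) :
    frame f S₁ S₂ x (frameInv f S₁ S₂ x v) = v := by
  have hsurj : Function.Surjective (frame f S₁ S₂ x).toLinearMap := by
    rw [← LinearMap.range_eq_top, eq_top_iff, ← h.span_eq x hx, Submodule.span_le]
    rintro _ ⟨c, rfl⟩
    refine ⟨EuclideanSpace.single c 1, ?_⟩
    classical
    change frame f S₁ S₂ x _ = _
    simp [frame_apply, ite_smul]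
  have hdim : Module.finrank ℝ (EuclideanSpace ℝ (Idx S₁ S₂)) = Module.finrank ℝ (Vec n) := by
    simp [h.card_eq]
  have hinj := (LinearMap.injective_iff_surjective_of_finrank_eq_finrank hdim).2 hsurj
  let e := (LinearEquiv.ofBijective (frame f S₁ S₂ x).toLinearMap
    ⟨hinj, hsurj⟩).toContinuousLinearEquiv
  have he : frame f S₁ S₂ x = (e : EuclideanSpace ℝ (Idx S₁ S₂) →L[ℝ] Vec n) := by
    ext; rfl
  rw [frameInv, he, ContinuousLinearMap.inverse_equiv]
  simp

lemma gradient_potential (xs : ℝ → Vec n) (x : Vec n) (t : ℝ) :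
    gradient (fun y => potential xs y t) x = (2 : ℝ) • (x - xs t) := by
  refine HasGradientAt.gradient (hasGradientAt_iff_hasFDerivAt.2 ?_)
  have h := (hasStrictFDerivAt_norm_sq (x - xs t)).hasFDerivAt.comp x
    ((hasFDerivAt_id x).sub_const (xs t))
  refine h.congr_fderiv ?_
  ext v
  simp [two_smul]

lemma frame_coeff (h : BracketGenerating D f S₁ S₂) {xs : ℝ → Vec n} {x : Vec n} (hx : x ∈ D)
    (γ t : ℝ) :
    frame f S₁ S₂ x (coeff f S₁ S₂ (potential xs) γ x t) = -((2 * γ) • (x - xs t)) := by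
  rw [coeff, gradient_potential, map_neg, map_smul, frame_frameInv h hx, smul_smul, mul_comm γ]

lemma abs_coeff_le {xs : ℝ → Vec n} {x : Vec n} {γ t MF : ℝ} (hγ : 0 ≤ γ)
    (hMF : ‖frameInv f S₁ S₂ x‖ ≤ MF) (c : Idx S₁ S₂) :
    |coeff f S₁ S₂ (potential xs) γ x t c| ≤ 2 * γ * MF * ‖x - xs t‖ := by
  rw [← Real.norm_eq_abs]
  refine (PiLp.norm_apply_le _ c).trans ?_
  rw [coeff, gradient_potential, norm_neg, norm_smul, Real.norm_of_nonneg hγ]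
  refine (mul_le_mul_of_nonneg_left ((frameInv f S₁ S₂ x).le_of_opNorm_le hMF _) hγ).trans
    (le_of_eq ?_)
  rw [norm_smul]
  norm_num
  ring

end frame

/-! ### The oscillating controls and their averaged effect. -/

section control

variable {n m : ℕ} {S₁ : Finset (Fin m)} {S₂ : Finset (Fin m × Fin m)} {κ : Fin m × Fin m → ℕ}

/-- The constant part of the `k`-th control. -/
def drift (a : EuclideanSpace ℝ (Idx S₁ S₂)) (k : Fin m) : ℝ :=
  ∑ i : {i : Fin m // i ∈ S₁}, a (Sum.inl i) * (if k = i.1 then 1 else 0)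

/-- The cosine amplitudes of the `k`-th control. -/
def cosAmp (κ : Fin m × Fin m → ℕ) (a : EuclideanSpace ℝ (Idx S₁ S₂)) (k : Fin m)
    (p : {p : Fin m × Fin m // p ∈ S₂}) : ℝ :=
  √|a (Sum.inr p)| * (2 * √(Real.pi * κ p.1)) *
    ((if k = p.1.1 then 1 else 0) * SignType.sign (a (Sum.inr p)))

/-- The sine amplitudes of the `k`-th control. -/
def sinAmp (κ : Fin m × Fin m → ℕ) (a : EuclideanSpace ℝ (Idx S₁ S₂)) (k : Fin m)
    (p : {p : Fin m × Fin m // p ∈ S₂}) : ℝ :=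
  √|a (Sum.inr p)| * (2 * √(Real.pi * κ p.1)) * (if k = p.1.2 then 1 else 0)

/-- A bound for the drift and the oscillating part of the controls when `|a_c| ≤ A`. -/
def controlBound (S₁ : Finset (Fin m)) (S₂ : Finset (Fin m × Fin m)) (κ : Fin m × Fin m → ℕ)
    (A : ℝ) : ℝ :=
  S₁.card * A + ∑ p : {p : Fin m × Fin m // p ∈ S₂}, 2 * (√A * (2 * √(Real.pi * κ p.1)))

lemma controlBound_nonneg {A : ℝ} (hA : 0 ≤ A) : 0 ≤ controlBound S₁ S₂ κ A := by
  unfold controlBound; positivity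

lemma control_eq {ε : ℝ} (hε : 0 < ε) (a : EuclideanSpace ℝ (Idx S₁ S₂)) (t : ℝ) (k : Fin m) :
    control S₁ S₂ κ ε a t k = drift a k + (√ε)⁻¹ *
      osc ε (fun p : {p : Fin m × Fin m // p ∈ S₂} => κ p.1) (cosAmp κ a k) (sinAmp κ a k) t := by
  rw [control, drift, Real.rpow_neg hε.le, ← Real.sqrt_eq_rpow, osc]
  congr 2
  refine Finset.sum_congr rfl fun p _ => ?_
  simp only [dither, cosAmp, sinAmp]
  ring

lemma continuous_control {ε : ℝ} (hε : 0 < ε) (a : EuclideanSpace ℝ (Idx S₁ S₂)) (k : Fin m) :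
    Continuous fun t => control S₁ S₂ κ ε a t k := by
  simp_rw [control_eq hε]; fun_prop

lemma abs_drift_le {a : EuclideanSpace ℝ (Idx S₁ S₂)} {A : ℝ} (hA : 0 ≤ A) (ha : ∀ c, |a c| ≤ A)
    (k : Fin m) : |drift a k| ≤ controlBound S₁ S₂ κ A := by
  have h1 : |drift a k| ≤ S₁.card * A := by
    refine (Finset.abs_sum_le_sum_abs _ _).trans
      ((Finset.sum_le_card_nsmul _ _ A fun i _ => ?_).trans ?_)
    · split_ifs
      · simpa using ha _
      · simpa using hA
    · simp
  refine h1.trans (le_add_of_nonneg_right ?_)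
  positivity

lemma abs_cosAmp_le {a : EuclideanSpace ℝ (Idx S₁ S₂)} {A : ℝ} (ha : ∀ c, |a c| ≤ A)
    (k : Fin m) (p : {p : Fin m × Fin m // p ∈ S₂}) :
    |cosAmp κ a k p| ≤ √A * (2 * √(Real.pi * κ p.1)) := by
  rw [cosAmp, abs_mul, abs_of_nonneg (by positivity)]
  have h1 : |(if k = p.1.1 then (1 : ℝ) else 0) * SignType.sign (a (Sum.inr p))| ≤ 1 := by
    rcases SignType.sign (a (Sum.inr p)) with _ | _ | _ <;> split_ifs <;> simp
  have h2 := Real.sqrt_le_sqrt (ha (Sum.inr p))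
  refine (mul_le_of_le_one_right (by positivity) h1).trans ?_
  gcongr

lemma abs_sinAmp_le {a : EuclideanSpace ℝ (Idx S₁ S₂)} {A : ℝ} (ha : ∀ c, |a c| ≤ A)
    (k : Fin m) (p : {p : Fin m × Fin m // p ∈ S₂}) :
    |sinAmp κ a k p| ≤ √A * (2 * √(Real.pi * κ p.1)) := by
  rw [sinAmp, abs_mul, abs_of_nonneg (by positivity)]
  have h1 : |(if k = p.1.2 then (1 : ℝ) else 0)| ≤ 1 := by split_ifs <;> simp
  have h2 := Real.sqrt_le_sqrt (ha (Sum.inr p))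
  refine (mul_le_of_le_one_right (by positivity) h1).trans ?_
  gcongr

lemma abs_osc_control_le {a : EuclideanSpace ℝ (Idx S₁ S₂)} {A : ℝ} (hA : 0 ≤ A)
    (ha : ∀ c, |a c| ≤ A) (ε : ℝ) (k : Fin m) (t : ℝ) :
    |osc ε (fun p : {p : Fin m × Fin m // p ∈ S₂} => κ p.1) (cosAmp κ a k) (sinAmp κ a k) t| ≤
      controlBound S₁ S₂ κ A := by
  refine (abs_osc_le _ _ _ _ _).trans ((Finset.sum_le_sum fun p _ => ?_).trans
    (le_add_of_nonneg_left (by positivity)))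
  linarith [abs_cosAmp_le (κ := κ) ha k p, abs_sinAmp_le (κ := κ) ha k p]

lemma abs_control_le {ε : ℝ} (hε : 0 < ε) (hε1 : ε ≤ 1) {a : EuclideanSpace ℝ (Idx S₁ S₂)} {A : ℝ}
    (hA : 0 ≤ A) (ha : ∀ c, |a c| ≤ A) (t : ℝ) (k : Fin m) :
    |control S₁ S₂ κ ε a t k| ≤ 2 * controlBound S₁ S₂ κ A * (√ε)⁻¹ := by
  have hs : 0 < √ε := Real.sqrt_pos.2 hε
  have hc1 : 1 ≤ (√ε)⁻¹ := (one_le_inv₀ hs).2 (Real.sqrt_le_one.2 hε1)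
  rw [control_eq hε]
  refine (abs_add_le _ _).trans ?_
  rw [abs_mul, abs_of_pos (by linarith : 0 < (√ε)⁻¹)]
  have h1 := abs_drift_le (κ := κ) hA ha k
  have h2 := abs_osc_control_le (κ := κ) hA ha ε k t
  nlinarith [controlBound_nonneg (S₁ := S₁) (S₂ := S₂) (κ := κ) hA]

/-- The normalisation of the dither is explained here: the two factors `2√(πκ)` cancel the `4πκ` of
the iterated integral, and `√|a| * √|a| * sign a` restores `a`. -/
lemma resonance_eq (hκpos : ∀ p ∈ S₂, 0 < κ p) (a : EuclideanSpace ℝ (Idx S₁ S₂)) (k l : Fin m)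
    (p : {p : Fin m × Fin m // p ∈ S₂}) :
    (sinAmp κ a k p * cosAmp κ a l p - cosAmp κ a k p * sinAmp κ a l p) /
        (4 * Real.pi * κ p.1) =
      a (Sum.inr p) * ((if k = p.1.2 then 1 else 0) * (if l = p.1.1 then 1 else 0) -
        (if k = p.1.1 then 1 else 0) * (if l = p.1.2 then 1 else 0)) := by
  have hk : (0 : ℝ) < κ p.1 := by exact_mod_cast hκpos p.1 p.2
  have hπ := Real.pi_pos
  have h1 : √(Real.pi * κ p.1) * √(Real.pi * κ p.1) = Real.pi * κ p.1 :=
    Real.mul_self_sqrt (by positivity)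
  have h2 : √|a (Sum.inr p)| * √|a (Sum.inr p)| = |a (Sum.inr p)| :=
    Real.mul_self_sqrt (abs_nonneg _)
  have h3 : |a (Sum.inr p)| * SignType.sign (a (Sum.inr p)) = a (Sum.inr p) := abs_mul_sign _
  have h4 : sinAmp κ a k p * cosAmp κ a l p - cosAmp κ a k p * sinAmp κ a l p =
      4 * (√|a (Sum.inr p)| * √|a (Sum.inr p)|) * (√(Real.pi * κ p.1) * √(Real.pi * κ p.1)) *
      SignType.sign (a (Sum.inr p)) *
      ((if k = p.1.2 then 1 else 0) * (if l = p.1.1 then 1 else 0) -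
        (if k = p.1.1 then 1 else 0) * (if l = p.1.2 then 1 else 0)) := by
    simp only [sinAmp, cosAmp]; ring
  have h5 : 4 * |a (Sum.inr p)| * (Real.pi * κ p.1) * SignType.sign (a (Sum.inr p)) =
      a (Sum.inr p) * (4 * Real.pi * κ p.1) := by
    linear_combination (4 * Real.pi * κ p.1) * h3
  rw [h4, h1, h2, h5]
  field_simp

/-- For a pair `(j₁, j₂)` the antisymmetric coefficient selects `L_{f_{j₁}} f_{j₂}` with weight `a`
and `L_{f_{j₂}} f_{j₁}` with weight `-a`, which is the bracket column; the drift supplies the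
columns from `S₁`. -/
lemma sum_drift_add_resonance (hκpos : ∀ p ∈ S₂, 0 < κ p) (f : Fin m → Vec n → Vec n)
    (a : EuclideanSpace ℝ (Idx S₁ S₂)) (z : Vec n) :
    ∑ k, drift a k • f k z + ∑ k, ∑ l, (∑ p : {p : Fin m × Fin m // p ∈ S₂},
        (sinAmp κ a k p * cosAmp κ a l p - cosAmp κ a k p * sinAmp κ a l p) /
          (4 * Real.pi * κ p.1)) • lieDer (f l) (f k) z = frame f S₁ S₂ z a := by
  rw [frame_apply, Fintype.sum_sum_type]
  congr 1
  · simp only [drift, Finset.sum_smul]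
    rw [Finset.sum_comm]
    refine Finset.sum_congr rfl fun i _ => ?_
    simp [column]
  · simp_rw [resonance_eq hκpos, Finset.sum_smul]
    rw [Finset.sum_congr rfl fun k _ => Finset.sum_comm, Finset.sum_comm]
    refine Finset.sum_congr rfl fun p _ => ?_
    simp only [mul_sub, sub_smul, Finset.sum_sub_distrib, column, bracket, smul_sub]
    congr 1
    · rw [Finset.sum_eq_single p.1.2 (by intro k _ hk; simp [hk]) (by simp),
        Finset.sum_eq_single p.1.1 (by intro k _ hk; simp [hk]) (by simp)]
      simp
    · rw [Finset.sum_eq_single p.1.1 (by intro k _ hk; simp [hk]) (by simp),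
        Finset.sum_eq_single p.1.2 (by intro k _ hk; simp [hk]) (by simp)]
      simp

/-- Over one sampling period the solution moves in the direction `𝓕(z) a`, up to
`O(ε^{3/2})`. -/
lemma norm_step_sub_le {D : Set (Vec n)} (hDo : IsOpen D) {f : Fin m → Vec n → Vec n}
    (hf : ∀ k, ContDiffOn ℝ 2 (f k) D) (hκpos : ∀ p ∈ S₂, 0 < κ p)
    (hκinj : Set.InjOn κ (S₂ : Set (Fin m × Fin m))) {ε : ℝ} (hε : 0 < ε) (hε1 : ε ≤ 1)
    {a : EuclideanSpace ℝ (Idx S₁ S₂)} {A : ℝ} (hA : 0 ≤ A) (ha : ∀ c, |a c| ≤ A)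
    {x : ℝ → Vec n} {s : ℝ}
    (hx : ∀ t ∈ Icc s (s + ε), HasDerivWithinAt x (∑ k, control S₁ S₂ κ ε a t k • f k (x t))
      (Icc s (s + ε)) t)
    (hxD : ∀ t ∈ Icc s (s + ε), x t ∈ D) {L2 H : ℝ} (hH0 : 0 ≤ H)
    (hL2 : ∀ j k, ‖lieDer (f j) (f k) (x s)‖ ≤ L2)
    (hH : ∀ t ∈ Icc s (s + ε), ∀ j k l, ‖lieDer (f l) (lieDer (f j) (f k)) (x t)‖ ≤ H) :
    ‖x (s + ε) - x s - ε • frame f S₁ S₂ (x s) a‖ ≤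
      ((m * (2 * controlBound S₁ S₂ κ A)) ^ 3 * H +
        m * (m * (3 * controlBound S₁ S₂ κ A ^ 2) * L2)) * (ε * √ε) := by
  set Q := controlBound S₁ S₂ κ A with hQdef
  have hQ : 0 ≤ Q := controlBound_nonneg hA
  have hs : 0 < √ε := Real.sqrt_pos.2 hε
  have hss : √ε * √ε = ε := Real.mul_self_sqrt hε.le
  have h1 := second_order_expansion hDo hf (continuous_control (κ := κ) hε a)
    (by linarith : s ≤ s + ε) hx hxD (U := 2 * Q * (√ε)⁻¹) (by positivity) hH0
    (fun k t => abs_control_le hε hε1 hA ha t k) hH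
  set J : Fin m → Fin m → ℝ := fun k l => ∫ t in s..s + ε, control S₁ S₂ κ ε a t k *
    ∫ τ in s..t, control S₁ S₂ κ ε a τ l with hJ
  set R : Fin m → Fin m → ℝ := fun k l => ∑ p : {p : Fin m × Fin m // p ∈ S₂},
    (sinAmp κ a k p * cosAmp κ a l p - cosAmp κ a k p * sinAmp κ a l p) /
          (4 * Real.pi * κ p.1) with hR
  have hJR : ∀ k l, |J k l - ε * R k l| ≤ 3 * Q ^ 2 * (ε * √ε) := by
    intro k l
    have hN : Function.Injective fun p : {p : Fin m × Fin m // p ∈ S₂} => κ p.1 :=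
      fun p q h => Subtype.ext (hκinj p.2 q.2 h)
    have hNpos : ∀ p : {p : Fin m × Fin m // p ∈ S₂}, 0 < κ p.1 := fun p => hκpos p.1 p.2
    have := abs_iterated_integral_sub_le hε hε1 hNpos hN (Q := Q) (abs_drift_le hA ha k)
      (abs_drift_le hA ha l) (abs_osc_control_le hA ha ε k) (abs_osc_control_le hA ha ε l) s
    simp only [hJ, control_eq hε]
    exact this
  have hI : ∀ k, ∫ t in s..s + ε, control S₁ S₂ κ ε a t k = ε * drift a k := by
    intro k
    simp only [control_eq hε]
    exact integral_const_add_osc hε (N := fun p : {p : Fin m × Fin m // p ∈ S₂} => κ p.1)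
      (fun p => hκpos p.1 p.2) _ _ _ _ s
  have h2 : ‖∑ k, (1 : ℝ) • ∑ l, (J k l - ε * R k l) • lieDer (f l) (f k) (x s)‖ ≤
      m * 1 * (m * (3 * Q ^ 2 * (ε * √ε)) * L2) :=
    norm_sum_smul_le (fun _ => by simp) fun k =>
      norm_sum_smul_le (fun l => hJR k l) fun l => hL2 l k
  -- The error splits into the remainder of the expansion and the replacement of each iterated
  -- integral by its resonant part; the single integrals are exact.
  have h3 : x (s + ε) - x s - ε • frame f S₁ S₂ (x s) a =
      (x (s + ε) - x s - ∑ k, (∫ t in s..s + ε, control S₁ S₂ κ ε a t k) • f k (x s) -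
        ∑ k, ∑ l, J k l • lieDer (f l) (f k) (x s)) +
      ∑ k, (1 : ℝ) • ∑ l, (J k l - ε * R k l) • lieDer (f l) (f k) (x s) := by
    rw [← sum_drift_add_resonance hκpos]
    simp only [hI, mul_smul, sub_smul, one_smul, Finset.sum_sub_distrib, ← Finset.smul_sum,
      smul_add]
    abel
  rw [h3]
  refine (norm_add_le _ _).trans ((add_le_add h1 h2).trans (le_of_eq ?_))
  have h4 : (√ε)⁻¹ * ε = √ε := by
    nth_rewrite 2 [← hss]; field_simp
  rw [add_sub_cancel_left, mul_assoc (m : ℝ), mul_assoc (2 * Q), h4]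
  linear_combination ((m * (2 * Q)) ^ 3 * H) * √ε * hss

end control

/-! ### Existence and uniqueness on one sampling interval. -/

section ode

variable {n m : ℕ} {D : Set (Vec n)} {f : Fin m → Vec n → Vec n}

lemma exists_lipschitzOnWith_of_isCompact (hDo : IsOpen D) {g : Vec n → Vec n}
    (hg : ContDiffOn ℝ 2 g D) {K : Set (Vec n)} (hK : IsCompact K) (hKD : K ⊆ D) :
    ∃ C, LipschitzOnWith C g K := by
  refine LocallyLipschitzOn.exists_lipschitzOnWith_of_compact hK fun x hx => ?_
  obtain ⟨C, s, hs, h⟩ := ((hg.contDiffAt (hDo.mem_nhds (hKD hx))).of_le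
    (by norm_num : (1 : WithTop ℕ∞) ≤ 2)).exists_lipschitzOnWith
  exact ⟨C, s, mem_nhdsWithin_of_mem_nhds hs, h⟩

lemma norm_sum_smul_sub_le {u : Fin m → ℝ} {U Lf : ℝ} (hU : ∀ k, |u k| ≤ U) {x y : Vec n}
    (h : ∀ k, ‖f k x - f k y‖ ≤ Lf * ‖x - y‖) :
    ‖∑ k, u k • f k x - ∑ k, u k • f k y‖ ≤ m * U * Lf * ‖x - y‖ := by
  rw [← Finset.sum_sub_distrib]
  simp_rw [← smul_sub]
  refine (norm_sum_smul_le hU h).trans (le_of_eq (by ring))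

/-- Solutions with values in `D` of a control system with `C²` vector fields are unique. -/
lemma eqOn_of_solutions (hDo : IsOpen D) (hf : ∀ k, ContDiffOn ℝ 2 (f k) D)
    {u : Fin m → ℝ → ℝ} (hu : ∀ k, Continuous (u k)) {a b : ℝ} {x y : ℝ → Vec n}
    (hxc : ContinuousOn x (Icc a b)) (hyc : ContinuousOn y (Icc a b))
    (hx : ∀ t ∈ Ico a b, HasDerivWithinAt x (∑ k, u k t • f k (x t)) (Ico a b) t)
    (hy : ∀ t ∈ Ico a b, HasDerivWithinAt y (∑ k, u k t • f k (y t)) (Ico a b) t)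
    (hxD : ∀ t ∈ Icc a b, x t ∈ D) (hyD : ∀ t ∈ Icc a b, y t ∈ D) (hxy : x a = y a) :
    EqOn x y (Icc a b) := by
  -- The fields are only locally Lipschitz on `D`, but the union of both trajectories is a compact
  -- subset of `D`, and a Lipschitz constant there suffices.
  set K := x '' Icc a b ∪ y '' Icc a b with hKdef
  have hK : IsCompact K := (isCompact_Icc.image_of_continuousOn hxc).union
    (isCompact_Icc.image_of_continuousOn hyc)
  have hKD : K ⊆ D := by
    rintro _ (⟨t, ht, rfl⟩ | ⟨t, ht, rfl⟩)
    exacts [hxD t ht, hyD t ht]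
  choose C hC using fun k => exists_lipschitzOnWith_of_isCompact hDo (hf k) hK hKD
  choose U hU using fun k => (isCompact_Icc (a := a) (b := b)).exists_bound_of_continuousOn
    (hu k).continuousOn
  have hlip : ∀ t ∈ Ico a b, LipschitzOnWith
      (Real.toNNReal (m * (∑ k, |U k|) * ∑ k, (C k : ℝ))) (fun v => ∑ k, u k t • f k v) K := by
    intro t ht
    refine LipschitzOnWith.of_dist_le_mul fun v hv w hw => ?_
    rw [Real.coe_toNNReal _ (by positivity), dist_eq_norm, dist_eq_norm]
    refine norm_sum_smul_sub_le (fun k => ?_) fun k => ?_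
    · exact (hU k t (Ico_subset_Icc_self ht)).trans ((le_abs_self _).trans
        (Finset.single_le_sum (f := fun k => |U k|) (fun _ _ => abs_nonneg _) (Finset.mem_univ k)))
    · have h1 := (hC k).dist_le_mul v hv w hw
      rw [dist_eq_norm, dist_eq_norm] at h1
      refine h1.trans ?_
      gcongr
      exact Finset.single_le_sum (f := fun k => (C k : ℝ)) (fun _ _ => NNReal.coe_nonneg _)
        (Finset.mem_univ k)
  exact ODE_solution_unique_of_mem_Icc_right (v := fun t v => ∑ k, u k t • f k v) (s := fun _ => K)
    hlip hxc
    (fun t ht => (hx t ht).mono_of_mem_nhdsWithin (Ico_mem_nhdsGE_of_mem ht))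
    (fun t ht => Or.inl ⟨t, Ico_subset_Icc_self ht, rfl⟩) hyc
    (fun t ht => (hy t ht).mono_of_mem_nhdsWithin (Ico_mem_nhdsGE_of_mem ht))
    (fun t ht => Or.inr ⟨t, Ico_subset_Icc_self ht, rfl⟩) hxy

lemma exists_solution_mem_closedBall {u : Fin m → ℝ → ℝ} (hu : ∀ k, Continuous (u k))
    {s ε d U Mf Lf : ℝ} {z : Vec n} (hε : 0 ≤ ε) (hU0 : 0 ≤ U) (hM0 : 0 ≤ Mf) (hL0 : 0 ≤ Lf)
    (hd : 0 ≤ d) (hU : ∀ k t, |u k t| ≤ U)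
    (hM : ∀ k, ∀ x ∈ Metric.closedBall z d, ‖f k x‖ ≤ Mf)
    (hL : ∀ k, ∀ x ∈ Metric.closedBall z d, ∀ y ∈ Metric.closedBall z d,
      ‖f k x - f k y‖ ≤ Lf * ‖x - y‖)
    (hstep : m * U * Mf * ε ≤ d) :
    ∃ x : ℝ → Vec n, x s = z ∧
      (∀ t ∈ Icc s (s + ε), HasDerivWithinAt x (∑ k, u k t • f k (x t)) (Icc s (s + ε)) t) ∧
      ∀ t, x t ∈ Metric.closedBall z d := by
  have hs : s ∈ Icc s (s + ε) := ⟨le_rfl, by linarith⟩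
  have hPL : IsPicardLindelof (fun t v => ∑ k, u k t • f k v) (tmin := s) (tmax := s + ε)
      ⟨s, hs⟩ z d.toNNReal 0 (m * U * Mf).toNNReal (m * U * Lf).toNNReal := by
    refine ⟨fun t _ => LipschitzOnWith.of_dist_le_mul fun v hv w hw => ?_, fun v _ => ?_,
      fun t _ v hv => ?_, ?_⟩
    · rw [Real.coe_toNNReal _ hd] at hv hw
      rw [Real.coe_toNNReal _ (by positivity), dist_eq_norm, dist_eq_norm]
      exact norm_sum_smul_sub_le (fun k => hU k t) fun k => hL k v hv w hw
    · fun_prop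
    · rw [Real.coe_toNNReal _ hd] at hv
      rw [Real.coe_toNNReal _ (by positivity)]
      exact norm_sum_smul_le (fun k => hU k t) fun k => hM k v hv
    · rw [Real.coe_toNNReal _ hd, Real.coe_toNNReal _ (by positivity)]
      simpa [hε] using hstep
  have hz : z ∈ Metric.closedBall z ((0 : NNReal) : ℝ) := by simp
  -- Using the Picard fixed point itself retains the fact that the curve stays in the ball.
  -- `compProj` clamps time to the interval, so this holds for every `t`.
  obtain ⟨α, hα⟩ := ODE.FunSpace.exists_isFixedPt_next hPL hz
  have hball : ∀ t, α.compProj t ∈ Metric.closedBall z d := fun t => by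
    have := ODE.FunSpace.compProj_mem_closedBall α hPL.mul_max_le (t := t)
    rwa [Real.coe_toNNReal _ hd] at this
  have hfix : ∀ t ∈ Icc s (s + ε), α.compProj t =
      ODE.picard (fun t v => ∑ k, u k t • f k v) s z α.compProj t := by
    intro t ht
    rw [ODE.FunSpace.compProj_of_mem ht]
    conv_lhs => rw [← hα.eq]
    rw [ODE.FunSpace.next_apply]
  refine ⟨α.compProj, ?_, fun t ht => ?_, hball⟩
  · rw [hfix s hs, ODE.picard_apply₀]
  · refine (ODE.hasDerivWithinAt_picard_Icc hs hPL.continuousOn_uncurry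
      (ODE.FunSpace.continuous_compProj α).continuousOn (fun t _ => ?_) z ht).congr hfix
      (hfix t ht)
    rw [Real.coe_toNNReal _ hd]
    exact hball t

end ode

/-! ### Concatenation of the pieces and absolute continuity. -/

section gluing

variable {n : ℕ}

/-- The concatenation of the curves `φ j` on the intervals `[t₀ + ε j, t₀ + ε (j + 1))`. -/
def concat (ε t₀ : ℝ) (φ : ℕ → ℝ → Vec n) (t : ℝ) : Vec n := φ ⌊(t - t₀) / ε⌋₊ t

lemma mem_Ico_floor {ε t₀ t : ℝ} (hε : 0 < ε) (ht : t₀ ≤ t) :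
    t ∈ Ico (t₀ + ε * ⌊(t - t₀) / ε⌋₊) (t₀ + ε * (⌊(t - t₀) / ε⌋₊ + 1)) := by
  have h0 : 0 ≤ (t - t₀) / ε := div_nonneg (by linarith) hε.le
  have h1 := Nat.floor_le h0
  have h2 := Nat.lt_floor_add_one ((t - t₀) / ε)
  rw [le_div_iff₀ hε] at h1
  rw [div_lt_iff₀ hε] at h2
  constructor <;> nlinarith

lemma floor_eq_of_mem_Ico {ε t₀ t : ℝ} (hε : 0 < ε) {j : ℕ}
    (ht : t ∈ Ico (t₀ + ε * j) (t₀ + ε * (j + 1))) : ⌊(t - t₀) / ε⌋₊ = j := by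
  have h1 : (j : ℝ) ≤ (t - t₀) / ε := by rw [le_div_iff₀ hε]; linarith [ht.1]
  rw [Nat.floor_eq_iff (j.cast_nonneg.trans h1)]
  exact ⟨h1, by rw [div_lt_iff₀ hε]; linarith [ht.2]⟩

lemma concat_eqOn {ε t₀ : ℝ} (hε : 0 < ε) {φ : ℕ → ℝ → Vec n}
    (hφ : ∀ j : ℕ, φ j (t₀ + ε * (j + 1)) = φ (j + 1) (t₀ + ε * (j + 1))) (j : ℕ) :
    EqOn (concat ε t₀ φ) (φ j) (Icc (t₀ + ε * j) (t₀ + ε * (j + 1))) := by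
  intro t ht
  rcases ht.2.lt_or_eq with h | rfl
  · rw [concat, floor_eq_of_mem_Ico hε ⟨ht.1, h⟩]
  · rw [concat, floor_eq_of_mem_Ico hε (j := j + 1), ← hφ]
    constructor
    · push_cast; exact le_rfl
    · push_cast; nlinarith

/-- A curve whose right derivatives are bounded on each of the consecutive intervals of length `ε`
is absolutely continuous. -/
lemma absolutelyContinuous_of_piecewise {ε t₀ C : ℝ} (hε : 0 < ε) (hC : 0 ≤ C) {x : ℝ → Vec n}
    {x' : ℝ → Vec n} (hx : ∀ j : ℕ, ∀ t ∈ Icc (t₀ + ε * j) (t₀ + ε * (j + 1)),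
      ContinuousWithinAt x (Icc (t₀ + ε * j) (t₀ + ε * (j + 1))) t)
    (hx' : ∀ j : ℕ, ∀ t ∈ Ico (t₀ + ε * j) (t₀ + ε * (j + 1)),
      HasDerivWithinAt x (x' t) (Ico (t₀ + ε * j) (t₀ + ε * (j + 1))) t)
    (hb : ∀ t, t₀ ≤ t → ‖x' t‖ ≤ C) (T : ℝ) (hT : t₀ ≤ T) :
    AbsolutelyContinuousOnInterval x t₀ T := by
  -- At a sampling instant only the right derivative is available. It is enough for the mean value
  -- inequality, and chaining over the nodes gives one global Lipschitz constant.
  have hright : ∀ t, t₀ ≤ t → HasDerivWithinAt x (x' t) (Ici t) t := fun t ht =>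
    (hx' _ t (mem_Ico_floor hε ht)).mono_of_mem_nhdsWithin
      (Ico_mem_nhdsGE_of_mem (mem_Ico_floor hε ht))
  have hpiece : ∀ j : ℕ, ∀ p ∈ Icc (t₀ + ε * j) (t₀ + ε * (j + 1)),
      ∀ q ∈ Icc (t₀ + ε * j) (t₀ + ε * (j + 1)), p ≤ q → ‖x q - x p‖ ≤ C * (q - p) := by
    intro j p hp q hq hpq
    have hj : t₀ ≤ t₀ + ε * j := by
      have : 0 ≤ ε * (j : ℝ) := by positivity
      linarith
    exact norm_image_sub_le_of_norm_deriv_right_le_segment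
      (fun t ht => (hx j t ⟨hp.1.trans ht.1, ht.2.trans hq.2⟩).mono (Icc_subset_Icc hp.1 hq.2))
      (fun t ht => hright t (hj.trans (hp.1.trans ht.1)))
      (fun t ht => hb t (hj.trans (hp.1.trans ht.1))) q ⟨hpq, le_rfl⟩
  have hmul : ∀ j : ℕ, ∀ p, t₀ ≤ p → p ≤ t₀ + ε * j →
      ‖x (t₀ + ε * j) - x p‖ ≤ C * (t₀ + ε * j - p) := by
    intro j
    induction j with
    | zero =>
      intro p h1 h2
      have : p = t₀ := by simp at h2; linarith
      subst this; simp
    | succ j ih =>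
      intro p h1 h2
      push_cast at h2 ⊢
      have hj : t₀ + ε * j ≤ t₀ + ε * (j + 1) := by nlinarith
      rcases le_total p (t₀ + ε * j) with h | h
      · have h3 := ih p h1 h
        have h4 := hpiece j _ ⟨le_rfl, hj⟩ _ ⟨hj, le_rfl⟩ hj
        have := norm_sub_le_norm_sub_add_norm_sub (x (t₀ + ε * (j + 1))) (x (t₀ + ε * j)) (x p)
        linarith
      · exact hpiece j _ ⟨h, h2⟩ _ ⟨hj, le_rfl⟩ h2
  have hall : ∀ p q, t₀ ≤ p → p ≤ q → ‖x q - x p‖ ≤ C * (q - p) := by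
    intro p q hp hpq
    have hq := mem_Ico_floor hε (hp.trans hpq)
    set j := ⌊(q - t₀) / ε⌋₊
    rcases le_total p (t₀ + ε * j) with h | h
    · have h3 := hmul j p hp h
      have h4 := hpiece j _ ⟨le_rfl, hq.1.trans hq.2.le⟩ _ (Ico_subset_Icc_self hq) hq.1
      have := norm_sub_le_norm_sub_add_norm_sub (x q) (x (t₀ + ε * j)) (x p)
      linarith
    · exact hpiece j _ ⟨h, hpq.trans hq.2.le⟩ _ (Ico_subset_Icc_self hq) hpq
  refine LipschitzOnWith.absolutelyContinuousOnInterval (K := C.toNNReal) ?_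
  rw [uIcc_of_le hT]
  refine LipschitzOnWith.of_dist_le_mul fun p hp q hq => ?_
  rw [Real.coe_toNNReal _ hC, dist_eq_norm, Real.dist_eq]
  rcases le_total p q with h | h
  · rw [norm_sub_rev, abs_sub_comm, abs_of_nonneg (by linarith)]
    exact hall p q hp.1 h
  · rw [abs_of_nonneg (by linarith)]
    exact hall q p hq.1 h

end gluing

/-! ### The closed loop: one step, uniqueness, and decay of the error. -/

variable {n m : ℕ} {D : Set (Vec n)} {f : Fin m → Vec n → Vec n}
  {S₁ : Finset (Fin m)} {S₂ : Finset (Fin m × Fin m)} {κ : Fin m × Fin m → ℕ} {xs : ℝ → Vec n}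

/-- Solutions of the closed loop over one sampling interval, with the coefficients frozen at
`(z, s)`: they exist, stay close to `z`, and approximate an Euler step of `ẋ = -2γ (x - x*)`. -/
lemma exists_step (hDo : IsOpen D) (hf : ∀ k, ContDiffOn ℝ 2 (f k) D)
    (hrank : BracketGenerating D f S₁ S₂) (hκpos : ∀ p ∈ S₂, 0 < κ p)
    (hκinj : Set.InjOn κ (S₂ : Set (Fin m × Fin m))) {R d r : ℝ} (hR : 0 ≤ R) (hd : 0 < d)
    (hRr : R + d ≤ r) (hKD : ∀ t, 0 ≤ t → Metric.closedBall (xs t) r ⊆ D)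
    (hreg : UniformlyRegular f (fun t => Metric.closedBall (xs t) r)) {γ : ℝ} (hγ : 0 < γ) :
    ∃ C : ℝ, 0 ≤ C ∧ ∃ ε₁ : ℝ, 0 < ε₁ ∧ ∀ ε, 0 < ε → ε ≤ ε₁ → ∃ V : ℝ, 0 ≤ V ∧
      ∀ s, 0 ≤ s → ∀ z, ‖z - xs s‖ ≤ R →
      ∃ x : ℝ → Vec n, x s = z ∧
        (∀ t ∈ Icc s (s + ε), HasDerivWithinAt x
          (∑ k, control S₁ S₂ κ ε (coeff f S₁ S₂ (potential xs) γ z s) t k • f k (x t))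
          (Icc s (s + ε)) t ∧
          ‖∑ k, control S₁ S₂ κ ε (coeff f S₁ S₂ (potential xs) γ z s) t k • f k (x t)‖ ≤ V) ∧
        (∀ t, x t ∈ D ∧ ‖x t - z‖ ≤ d) ∧
        ‖x (s + ε) - z + (2 * γ * ε) • (z - xs s)‖ ≤ C * (ε * √ε) := by
  obtain ⟨Mf, Lf, L2, H, hMf, hLf, hL2, hH, hreg⟩ := hreg
  obtain ⟨MF, hMF, hinv⟩ := hrank.inv_bound (fun t => Metric.closedBall (xs t) r)
    fun t ht => ⟨isCompact_closedBall _ _, hKD t ht⟩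
  set A := 2 * γ * MF * R with hAdef
  have hA : 0 ≤ A := by positivity
  set Q := controlBound S₁ S₂ κ A with hQdef
  have hQ : 0 ≤ Q := controlBound_nonneg hA
  -- The displacement over one period is at most `m * (2 * Q) * Mf * √ε`, so `√ε ≤ w` keeps the
  -- solution within `d` of `z`; the `+ 1` keeps the denominator positive. The error constant chosen
  -- next does not depend on `ε`, whereas the speed bound does.
  set w := d / (m * (2 * Q) * Mf + 1) with hwdef
  have hw : 0 < w := by positivity
  refine ⟨(m * (2 * Q)) ^ 3 * H + m * (m * (3 * Q ^ 2) * L2), by positivity, min 1 (w ^ 2),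
    by positivity, fun ε hε hε1 => ⟨m * (2 * Q * (√ε)⁻¹) * Mf, by positivity,
    fun s hs z hz => ?_⟩⟩
  have hε1' : ε ≤ 1 := hε1.trans (min_le_left _ _)
  have hsw : √ε ≤ w := Real.sqrt_le_iff.2 ⟨hw.le, hε1.trans (min_le_right _ _)⟩
  have hsε : 0 < √ε := Real.sqrt_pos.2 hε
  have hss : √ε * √ε = ε := Real.mul_self_sqrt hε.le
  have hball : Metric.closedBall z d ⊆ Metric.closedBall (xs s) r := by
    refine Metric.closedBall_subset_closedBall' ?_
    rw [dist_eq_norm]; linarith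
  have hzK : z ∈ Metric.closedBall (xs s) r := hball (Metric.mem_closedBall_self hd.le)
  have hzD : z ∈ D := hKD s hs hzK
  set a := coeff f S₁ S₂ (potential xs) γ z s with ha_def
  have ha : ∀ c, |a c| ≤ A := fun c =>
    (abs_coeff_le hγ.le (hinv s hs z hzK) c).trans (mul_le_mul_of_nonneg_left hz (by positivity))
  have hstep : m * (2 * Q * (√ε)⁻¹) * Mf * ε ≤ d := by
    have h1 : m * (2 * Q * (√ε)⁻¹) * Mf * ε = (m * (2 * Q) * Mf) * √ε := by
      nth_rewrite 2 [← hss]; field_simp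
    rw [h1]
    have h2 : (m * (2 * Q) * Mf + 1) * w = d := by
      rw [hwdef]; field_simp
    have h3 : 0 ≤ m * (2 * Q) * Mf := by positivity
    nlinarith
  have hU : ∀ k t, |control S₁ S₂ κ ε a t k| ≤ 2 * Q * (√ε)⁻¹ :=
    fun k t => abs_control_le hε hε1' hA ha t k
  obtain ⟨x, hxs, hx, hxb⟩ := exists_solution_mem_closedBall (f := f) (z := z) (s := s) (ε := ε)
    (d := d) (U := 2 * Q * (√ε)⁻¹) (Mf := Mf) (Lf := Lf)
    (continuous_control (κ := κ) hε a) hε.le (by positivity) hMf.le hLf.le hd.le hU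
    (fun k y hy => (hreg s hs y (hball hy) y (hball hy) k k k).1)
    (fun k y hy y' hy' => (hreg s hs y (hball hy) y' (hball hy') k k k).2.1) hstep
  have hxK : ∀ t, x t ∈ Metric.closedBall (xs s) r := fun t => hball (hxb t)
  have hxD : ∀ t, x t ∈ D := fun t => hKD s hs (hxK t)
  refine ⟨x, hxs, fun t ht => ⟨hx t ht, norm_sum_smul_le (fun k => hU k t) fun k =>
    (hreg s hs _ (hxK t) _ (hxK t) k k k).1⟩,
    fun t => ⟨hxD t, by rw [← dist_eq_norm]; exact hxb t⟩, ?_⟩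
  have h := norm_step_sub_le hDo hf hκpos hκinj hε hε1' hA ha hx (fun t _ => hxD t) hH
    (fun j k => (hreg s hs _ (hxK s) _ (hxK s) j k k).2.2.1)
    (fun t _ j k l => (hreg s hs _ (hxK t) _ (hxK t) j k l).2.2.2)
  rw [hxs, ha_def, frame_coeff hrank hzD, smul_neg, sub_neg_eq_add, smul_smul,
    mul_comm ε] at h
  exact h

/-- Two `π_ε`-solutions of the closed loop with the same initial value coincide. -/
lemma eqOn_of_isClosedLoopSolution (hDo : IsOpen D) (hf : ∀ k, ContDiffOn ℝ 2 (f k) D)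
    {γ ε t₀ : ℝ} (hε : 0 < ε) {x₀ : Vec n} {x y : ℝ → Vec n}
    (hx : IsClosedLoopSolution D f S₁ S₂ κ xs γ ε t₀ x₀ x)
    (hy : IsClosedLoopSolution D f S₁ S₂ κ xs γ ε t₀ x₀ y) : EqOn y x (Ici t₀) := by
  have hj0 : ∀ j : ℕ, t₀ ≤ t₀ + ε * j := fun j => by
    have : 0 ≤ ε * (j : ℝ) := by positivity
    linarith
  have hcont : ∀ {v : ℝ → Vec n}, IsClosedLoopSolution D f S₁ S₂ κ xs γ ε t₀ x₀ v → ∀ j : ℕ,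
      ContinuousOn v (Icc (t₀ + ε * j) (t₀ + ε * (j + 1))) := by
    intro v hv j
    have h1 : t₀ ≤ t₀ + ε * (j + 1) := by have := hj0 (j + 1); push_cast at this; exact this
    have := (hv.absCont _ h1).continuousOn
    rw [uIcc_of_le h1] at this
    exact this.mono (Icc_subset_Icc (hj0 j) le_rfl)
  have key : ∀ j : ℕ, y (t₀ + ε * j) = x (t₀ + ε * j) →
      EqOn y x (Icc (t₀ + ε * j) (t₀ + ε * (j + 1))) := by
    intro j hj
    -- Equal states at the node give equal frozen coefficients, so on this interval both curves
    -- solve the same equation.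
    have hyo := hy.ode j
    rw [hj] at hyo
    exact eqOn_of_solutions hDo hf (continuous_control (κ := κ) hε _) (hcont hy j) (hcont hx j)
      hyo (hx.ode j) (fun t ht => hy.mem t ((hj0 j).trans ht.1))
      (fun t ht => hx.mem t ((hj0 j).trans ht.1)) hj
  have hnode : ∀ j : ℕ, y (t₀ + ε * j) = x (t₀ + ε * j) := by
    intro j
    induction j with
    | zero => simp [hx.init, hy.init]
    | succ j ih =>
      push_cast
      exact key j ih ⟨by nlinarith, le_rfl⟩
  intro t ht
  exact key _ (hnode _) (Ico_subset_Icc_self (mem_Ico_floor hε ht))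

/-- The tubes around the reference curve are exponentially attracting for the closed loop. -/
theorem exponentiallyAttracting_tube {n m : ℕ} (D : Set (Vec n)) (hDo : IsOpen D)
    (f : Fin m → Vec n → Vec n) (hf : ∀ k, ContDiffOn ℝ 2 (f k) D)
    (S₁ : Finset (Fin m)) (S₂ : Finset (Fin m × Fin m))
    (hrank : BracketGenerating D f S₁ S₂)
    (κ : Fin m × Fin m → ℕ) (hκpos : ∀ p ∈ S₂, 0 < κ p)
    (hκinj : Set.InjOn κ (S₂ : Set (Fin m × Fin m)))
    (xs : ℝ → Vec n) (L : NNReal) (hxs : LipschitzOnWith L xs (Set.Ici 0))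
    (δ : ℝ) (htube : ∀ t, 0 ≤ t → Metric.ball (xs t) δ ⊆ D)
    (hreg : ∀ r, 0 < r → r < δ →
      UniformlyRegular f (fun t => Metric.closedBall (xs t) r))
    (ρ : ℝ) (hρ : 0 < ρ) (hρδ : ρ < δ) :
    ExponentiallyAttracting D f S₁ S₂ κ xs ρ := by
  -- Sampled states will stay within `R = ρ + Δ` of the curve and the motion between samples within
  -- `r = ρ + 2Δ = δ - Δ`, where the regularity bounds are available.
  set Δ := (δ - ρ) / 3 with hΔ
  have hΔ0 : 0 < Δ := by rw [hΔ]; linarith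
  set R := ρ + Δ with hR
  set r := ρ + 2 * Δ with hr
  have hrδ : r < δ := by rw [hr, hΔ]; linarith
  have hr0 : 0 < r := by positivity
  -- `d ≤ Δ` gives `R + d ≤ r`. The bound `ρ / 8` serves the final budget `ρ/2 + ρ/8 + ρ/8 = 3ρ/4`:
  -- sampled error, motion of the state, motion of the reference.
  set d := min Δ (ρ / 8) with hd
  have hd0 : 0 < d := by positivity
  have hdρ : d ≤ ρ / 8 := min_le_right _ _
  have hdΔ : d ≤ Δ := min_le_left _ _
  have hKD : ∀ t, 0 ≤ t → Metric.closedBall (xs t) r ⊆ D := fun t ht =>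
    (Metric.closedBall_subset_ball hrδ).trans (htube t ht)
  have hR0 : 0 ≤ R := by positivity
  have hL0 : (0 : ℝ) ≤ L := L.coe_nonneg
  have hxsL : ∀ s t, 0 ≤ s → s ≤ t → ‖xs s - xs t‖ ≤ L * (t - s) := by
    intro s t hs hst
    have := hxs.dist_le_mul s hs t (hs.trans hst)
    rwa [dist_eq_norm, Real.dist_eq, abs_sub_comm, abs_of_nonneg (by linarith)] at this
  have hstep := fun γ (hγ : 0 < γ) => exists_step (κ := κ) hDo hf hrank hκpos hκinj hR0 hd0
    (by linarith : R + d ≤ r) hKD (hreg r hr0 hrδ) hγ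
  choose! C hC ε₁ hε₁ V hV φ hφ0 hφ hφD hφe using hstep
  -- The gain threshold encodes `L + 1 ≤ γ * ρ`. The four bounds on `ε` give, in order, the one-step
  -- estimate, `C * √ε ≤ 1`, `2 * γ * ε ≤ 1` and `L * ε ≤ ρ / 8`.
  refine ⟨Δ, hΔ0, (L + 1) / ρ, by positivity, fun γ =>
    min (min (ε₁ γ) ((1 / (C γ + 1)) ^ 2)) (min (1 / (2 * γ)) (ρ / (8 * (L + 1)))), ?_, ?_⟩
  · intro γ hγ
    have hγ0 : 0 < γ := lt_of_lt_of_le (by positivity) hγ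
    have := hε₁ γ hγ0
    have := hC γ hγ0
    positivity
  intro t₀ ht₀ x₀ hx₀ γ hγ ε hε
  have hγ0 : 0 < γ := lt_of_lt_of_le (by positivity) hγ
  obtain ⟨hε0, hεle⟩ := hε
  have hC0 := hC γ hγ0
  have hεε₁ : ε ≤ ε₁ γ := hεle.trans ((min_le_left _ _).trans (min_le_left _ _))
  have hCε : C γ * √ε ≤ 1 := by
    have h1 : √ε ≤ 1 / (C γ + 1) := Real.sqrt_le_iff.2
      ⟨by positivity, hεle.trans ((min_le_left _ _).trans (min_le_right _ _))⟩
    rw [le_div_iff₀ (by positivity)] at h1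
    nlinarith [Real.sqrt_nonneg ε]
  have hq1 : 2 * γ * ε ≤ 1 := by
    have h1 : ε ≤ 1 / (2 * γ) := hεle.trans ((min_le_right _ _).trans (min_le_left _ _))
    rw [le_div_iff₀ (by positivity)] at h1
    linarith
  have hLε : L * ε ≤ ρ / 8 := by
    have h1 : ε ≤ ρ / (8 * (L + 1)) := hεle.trans ((min_le_right _ _).trans (min_le_right _ _))
    rw [le_div_iff₀ (by positivity)] at h1
    nlinarith
  have hLγ : L + 1 ≤ γ * ρ := by rwa [div_le_iff₀ hρ] at hγ
  set q := 2 * γ * ε with hq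
  have hq0 : 0 < q := by positivity
  have hx₀R : ‖x₀ - xs t₀‖ ≤ R := by
    obtain ⟨y, hy, hxy⟩ := Metric.mem_thickening_iff.1 hx₀.1
    rw [dist_eq_norm] at hxy
    have := norm_sub_le_norm_sub_add_norm_sub x₀ y (xs t₀)
    linarith [hy.2]
  -- the values at the sampling instants
  let T : ℕ → ℝ := fun j => t₀ + ε * j
  have hT0 : ∀ j, 0 ≤ T j := fun j => by positivity
  have hTs : ∀ j, T j + ε = T (j + 1) := fun j => by simp only [T]; push_cast; ring
  let z : ℕ → Vec n := fun j => Nat.rec x₀ (fun j v => φ γ ε (T j) v (T (j + 1))) j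
  have hz0 : z 0 = x₀ := rfl
  have hzs : ∀ j, z (j + 1) = φ γ ε (T j) (z j) (T (j + 1)) := fun j => rfl
  have hrec : ∀ j, ‖z j - xs (T j)‖ ≤ R →
      ‖z (j + 1) - xs (T (j + 1))‖ ≤ (1 - q) * ‖z j - xs (T j)‖ + q * (ρ / 2) := by
    intro j hj
    have h1 := hφe γ hγ0 ε hε0 hεε₁ (T j) (hT0 j) (z j) hj
    rw [hTs, ← hzs] at h1
    have h2 := hxsL (T j) (T (j + 1)) (hT0 j) (by rw [← hTs]; linarith)
    rw [← hTs, add_sub_cancel_left, hTs] at h2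
    have h3 : z (j + 1) - xs (T (j + 1)) = (z (j + 1) - z j + q • (z j - xs (T j))) +
        ((1 - q) • (z j - xs (T j)) + (xs (T j) - xs (T (j + 1)))) := by
      rw [sub_smul, one_smul]; abel
    have h4 : ‖(1 - q) • (z j - xs (T j))‖ = (1 - q) * ‖z j - xs (T j)‖ := by
      rw [norm_smul, Real.norm_of_nonneg (by linarith)]
    have h5 : ‖z (j + 1) - xs (T (j + 1))‖ ≤
        C γ * (ε * √ε) + ((1 - q) * ‖z j - xs (T j)‖ + L * ε) := by
      rw [h3, ← h4]
      exact (norm_add_le _ _).trans (add_le_add h1 ((norm_add_le _ _).trans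
        (add_le_add le_rfl h2)))
    -- The left side is at most `(L + 1) * ε ≤ γ * ρ * ε`, which equals `q * (ρ / 2)`.
    have h6 : C γ * (ε * √ε) + L * ε ≤ q * (ρ / 2) := by
      rw [hq]; nlinarith
    linarith
  -- The recursion bounds the next error by a convex combination of the current one and `ρ / 2 ≤ R`,
  -- so the ball of radius `R` is invariant and the one-step estimate can be iterated.
  have hzR : ∀ j, ‖z j - xs (T j)‖ ≤ R := by
    intro j
    induction j with
    | zero => simpa [hz0, T] using hx₀R
    | succ j ih =>
      refine (hrec j ih).trans ?_
      have : ρ / 2 ≤ R := by linarith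
      nlinarith
  have hzdecay : ∀ j, ‖z j - xs (T j)‖ ≤ (1 - q) ^ j * ‖x₀ - xs t₀‖ + ρ / 2 := by
    intro j
    induction j with
    | zero => simp [hz0, T]; positivity
    | succ j ih =>
      refine (hrec j (hzR j)).trans ?_
      rw [pow_succ']
      nlinarith
  -- the solution
  let ψ : ℕ → ℝ → Vec n := fun j => φ γ ε (T j) (z j)
  have hψ : ∀ j : ℕ, ψ j (t₀ + ε * (j + 1)) = ψ (j + 1) (t₀ + ε * (j + 1)) := by
    intro j
    have h1 : t₀ + ε * (j + 1) = T (j + 1) := by simp [T]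
    simp only [ψ]
    rw [h1, ← hzs, hφ0 γ hγ0 ε hε0 hεε₁ _ (hT0 _) _ (hzR _)]
  have heq := concat_eqOn hε0 hψ
  set x := concat ε t₀ ψ with hxdef
  have hxT : ∀ j : ℕ, x (t₀ + ε * j) = z j := fun j => by
    rw [heq j ⟨le_rfl, by nlinarith⟩]
    exact hφ0 γ hγ0 ε hε0 hεε₁ _ (hT0 _) _ (hzR _)
  have hxD : ∀ t, x t ∈ D := fun t => (hφD γ hγ0 ε hε0 hεε₁ _ (hT0 _) _ (hzR _) t).1
  have hIcc : ∀ j : ℕ, Icc (t₀ + ε * j) (t₀ + ε * (j + 1)) = Icc (T j) (T j + ε) := fun j => by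
    rw [hTs]; simp [T]
  have hder : ∀ j : ℕ, ∀ t ∈ Icc (t₀ + ε * j) (t₀ + ε * (j + 1)), HasDerivWithinAt x
      (∑ k, control S₁ S₂ κ ε (coeff f S₁ S₂ (potential xs) γ (z j) (T j)) t k • f k (x t))
      (Icc (t₀ + ε * j) (t₀ + ε * (j + 1))) t := by
    intro j t ht
    have h1 := (hφ γ hγ0 ε hε0 hεε₁ (T j) (hT0 j) (z j) (hzR j) t (by rwa [← hIcc])).1
    rw [← hIcc] at h1
    rw [heq j ht]
    exact h1.congr (heq j) (heq j ht)
  let J : ℝ → ℕ := fun t => ⌊(t - t₀) / ε⌋₊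
  have hsol : IsClosedLoopSolution D f S₁ S₂ κ xs γ ε t₀ x₀ x := by
    refine ⟨fun t _ => hxD t, ?_, ?_, ?_⟩
    · refine absolutelyContinuous_of_piecewise hε0 (hV γ hγ0 ε hε0 hεε₁)
        (x' := fun t => ∑ k, control S₁ S₂ κ ε
          (coeff f S₁ S₂ (potential xs) γ (z (J t)) (T (J t))) t k • f k (x t))
        (fun j t ht => (hder j t ht).continuousWithinAt) (fun j t ht => ?_) (fun t ht => ?_)
      · have hJ : J t = j := floor_eq_of_mem_Ico hε0 ht
        rw [hJ]
        exact (hder j t (Ico_subset_Icc_self ht)).mono Ico_subset_Icc_self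
      · have h1 := Ico_subset_Icc_self (mem_Ico_floor hε0 ht)
        rw [heq _ h1]
        rw [hIcc] at h1
        exact (hφ γ hγ0 ε hε0 hεε₁ _ (hT0 _) _ (hzR _) t h1).2
    · simpa [hz0] using hxT 0
    · intro j t ht
      rw [hxT j]
      exact (hder j t (Ico_subset_Icc_self ht)).mono Ico_subset_Icc_self
  have hbound : ∀ t, t₀ ≤ t →
      ‖x t - xs t‖ ≤ (1 - q) ^ (J t) * ‖x₀ - xs t₀‖ + 3 / 4 * ρ := by
    intro t ht
    have h1 := mem_Ico_floor hε0 ht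
    have h2 : ‖x t - z (J t)‖ ≤ d :=
      (hφD γ hγ0 ε hε0 hεε₁ (T (J t)) (hT0 _) _ (hzR _) t).2
    have h3 := hxsL (T (J t)) t (hT0 _) h1.1
    have h4 : t - T (J t) ≤ ε := by
      have := h1.2
      simp only [T, J]
      linarith
    have h5 : L * (t - T (J t)) ≤ L * ε := by gcongr
    have h6 := norm_sub_le_norm_sub_add_norm_sub (x t) (z (J t)) (xs t)
    have h7 := norm_sub_le_norm_sub_add_norm_sub (z (J t)) (xs (T (J t))) (xs t)
    have h8 := hzdecay (J t)
    linarith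
  have hpow : ∀ j : ℕ, (1 - q) ^ j ≤ Real.exp (-2 * γ * (ε * j)) := by
    intro j
    have h1 : 1 - q ≤ Real.exp (-q) := by linarith [Real.add_one_le_exp (-q)]
    refine (pow_le_pow_left₀ (by linarith) h1 j).trans (le_of_eq ?_)
    rw [← Real.exp_nat_mul]
    congr 1
    rw [hq]; ring
  have hfast : ∀ t, t₀ ≤ t →
      ‖x t - xs t‖ ≤ ‖x₀ - xs t₀‖ * Real.exp (-2 * γ * (t - t₀ - ε)) + 3 / 4 * ρ := by
    intro t ht
    refine (hbound t ht).trans ?_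
    rw [mul_comm]
    have h1 := (mem_Ico_floor hε0 ht).2
    gcongr
    refine (hpow _).trans (Real.exp_le_exp.2 ?_)
    -- The last node lies less than `ε` before `t`; this is the source of the shift by `ε` in the
    -- exponent.
    have h2 : t - t₀ - ε ≤ ε * J t := by simp only [J]; linarith
    exact mul_le_mul_of_nonpos_left h2 (by linarith)
  refine ⟨x, hsol, fun y hy => eqOn_of_isClosedLoopSolution hDo hf hε0 hsol hy, ?_, ?_⟩
  · have hlim : Tendsto (fun t => ‖x₀ - xs t₀‖ * Real.exp (-2 * γ * (t - t₀ - ε))) atTop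
        (𝓝 (‖x₀ - xs t₀‖ * 0)) := by
      refine Tendsto.const_mul _ (Real.tendsto_exp_atBot.comp ?_)
      refine Tendsto.const_mul_atTop_of_neg (by linarith) ?_
      simp only [sub_sub]
      exact tendsto_atTop_add_const_right _ _ tendsto_id
    rw [mul_zero] at hlim
    -- Once the exponential term is below `ρ / 4`, the solution lies in the tube, so the distance is
    -- eventually exactly zero.
    refine tendsto_const_nhds.congr' ?_
    filter_upwards [hlim.eventually_lt_const (by positivity : (0 : ℝ) < ρ / 4),
      eventually_ge_atTop t₀] with t h1 h2
    have : x t ∈ tube D xs ρ t := ⟨hxD t, by linarith [hfast t h2]⟩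
    exact (Metric.infDist_zero_of_mem this).symm
  · intro γs hγs hγsγ t ht
    have hγs0 : 0 < γs := lt_of_lt_of_le (by positivity) hγs
    -- For `t - t₀ < ε` the exponent is positive and replacing `γ` by the smaller `γs` decreases the
    -- exponential, so `hfast` is no use there. Instead the power in `hbound` is at most `1`, while
    -- the exponential is at least `1`.
    rcases le_total ε (t - t₀) with h | h
    · refine (hfast t ht).trans ?_
      have h1 : -2 * γ * (t - t₀ - ε) ≤ -2 * γs * (t - t₀ - ε) :=
        mul_le_mul_of_nonneg_right (by linarith) (by linarith)
      gcongr
      linarith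
    · refine (hbound t ht).trans ?_
      have h1 : (1 - q) ^ (J t) ≤ 1 := pow_le_one₀ (by linarith) (by linarith)
      have h2 : 1 ≤ Real.exp (-2 * γs * (t - t₀ - ε)) := by
        rw [Real.one_le_exp_iff]
        exact mul_nonneg_of_nonpos_of_nonpos (by linarith) (by linarith)
      have h3 := mul_le_mul_of_nonneg_right h1 (norm_nonneg (x₀ - xs t₀))
      have h4 := mul_le_mul_of_nonneg_left h2 (norm_nonneg (x₀ - xs t₀))
      linarith

end Tracking

end

theorem mainTheorem7 {n m : ℕ} (D : Set (Tracking.Vec n)) (hDo : IsOpen D) (hDc : IsConnected D)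
    (f : Fin m → Tracking.Vec n → Tracking.Vec n) (hf : ∀ k, ContDiffOn ℝ 2 (f k) D)
    (S₁ : Finset (Fin m)) (S₂ : Finset (Fin m × Fin m))
    (hrank : Tracking.BracketGenerating D f S₁ S₂)
    (κ : Fin m × Fin m → ℕ) (hκpos : ∀ p ∈ S₂, 0 < κ p) (hκinj : Set.InjOn κ (S₂ : Set (Fin m × Fin m)))
    (xs : ℝ → Tracking.Vec n) (L : NNReal) (hxs : LipschitzOnWith L xs (Set.Ici 0))
    (δ : ℝ) (hδ : 0 < δ) (htube : ∀ t, 0 ≤ t → Metric.ball (xs t) δ ⊆ D)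
    (hreg : ∀ r, 0 < r → r < δ →
      Tracking.UniformlyRegular f (fun t => Metric.closedBall (xs t) r))
    (ρ : ℝ) (hρ : 0 < ρ) (hρδ : ρ < δ) :
    Tracking.ExponentiallyAttracting D f S₁ S₂ κ xs ρ :=
  Tracking.exponentiallyAttracting_tube D hDo f hf S₁ S₂ hrank κ hκpos hκinj xs L hxs δ htube hreg ρ hρ hρδ
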